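/- Let $G=(V,E)$ be a simple graph with countable vertex set, and let $p(x,y)\ge 0$ $(x,y\in V)$ be the transition probabilities of a nearest neighbour random walk on $G$: $p(x,y)=0$ unless $x\sim y$, and $\sum_y p(x,y)=1$. Assume that the transition operator $Tf(x)=\sum_{y}p(x,y)f(y)$ is selfadjoint on $\ell^2(V)$, i.e. $p(x,y)=p(y,x)$. Let $H$ be a finite set of lamp states with $m=|H|$ elements, one of which is "off", and let $\mathfrak C$ be the set of configurations $\eta:V\to H$ that are off at all but finitely many vertices. The lamplighter transition operator $\widetilde T$ on $\ell^2(\mathfrak C\times V)=\ell^2(\mathfrak C)\otimes\ell^2(V)$ is the operator with transition probabilities $\tilde p(\xi,x;\eta,y)=p(x,y)/m^2$ if $x\sim y$ and $\xi,\eta$ coincide outside $\{x,y\}$, and $0$ otherwise. For $x\in V$ let $\Theta_x$ be the averaging operator on $\ell^2(\mathfrak C)$, $\Theta_xf(\eta)=\frac1m\sum_{\eta'}f(\eta')$, where $\eta'$ runs over the $m$ configurations coinciding with $\eta$ outside $x$. For a finite set $A\subseteq V$ let $dA=\{y\notin A: y\sim x\text{ for some }x\in A\}$, let $\Theta_{A,dA}=\prod_{x\in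 A}\Theta_x\prod_{y\in dA}(I-\Theta_y)$ (to be read as the strong limit, which is $0$ for $m\ge 2$, if $dA$ is infinite), let $P_A$ be the projection of $\ell^2(V)$ onto the functions supported in $A$, and let $T_A=P_ATP_A$. Let $p_c\in[0,1]$ be the critical parameter of Bernoulli site percolation on $G$, i.e. the infimum of all $q\in[0,1]$ for which some open cluster is infinite with positive probability ($p_c=1$ if there is no such $q$). Assume the subcritical regime $1/m<p_c$. Then $\widetilde T$ has a complete orthonormal system of finitely supported eigenfunctions. Explicitly: 1. For every finite connected nonempty $A\subseteq V$, $\ell^2(A)$ has an orthonormal basis $(f_{A,a})_{a\in A}$ of eigenvectors of $T_A$, with real eigenvalues $\lambda_{A,a}$. Moreover, $\mathfrak C$ is countable. 2. Fix any sequence that enumerates $\mathfrak C$ (repetitions allowed). For every finite connected nonempty $A$, the Gram–Schmidt procedure applied to $(\Theta_{A,dA}e_\eta)_{\eta\in\mathfrak C}$, dropping the zero vectors, gives an orthonormal basis $(\varphi_{A,i})_i$ of $\Theta_{A,dA}\ell^2(\mathfrak C)$ consisting of finitely supported functions; and for every $x\in V$ the Gram–Schmidt procedure applied to $((I-\Theta_x)e_\eta)_{\eta\in\mathfrak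 C}$ gives an orthonormal basis $(\psi_{x,i})_i$ of $(I-\Theta_x)\ell^2(\mathfrak C)$ consisting of finitely supported functions. 3. For any choice of the enumeration in 2 and of the eigenbases in 1, the functions $\varphi_{A,i}\otimes f_{A,a}$ ($A$ finite, connected, nonempty, $a\in A$) together with the functions $\psi_{x,i}\otimes e_x$ ($x\in V$) form a complete orthonormal system of $\ell^2(\mathfrak C\times V)$; they are finitely supported, and $\widetilde T(\varphi_{A,i}\otimes f_{A,a})=\lambda_{A,a}\,\varphi_{A,i}\otimes f_{A,a}$, $\widetilde T(\psi_{x,i}\otimes e_x)=0$. In particular the spectrum of $\widetilde T$ is pure point: for every $f\in\ell^2(\mathfrak C\times V)$, the spectral measure $\langle dE(t)f,f\rangle$ of $\widetilde T$ is concentrated on a countable set. -/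

import Mathlib

open scoped ENNReal

namespace Lamplighter

noncomputable section

/-! ### Square summable functions and symmetric Markov operators -/

/-- The Hilbert space of square summable complex functions on `X`. -/
abbrev L2 (X : Type*) := lp (fun _ : X => ℂ) 2

/-- The standard basis vector at `x`. -/
def basisVec {X : Type*} (x : X) : L2 X := by
  classical exact lp.single 2 x (1 : ℂ)

/-- `f` vanishes outside a finite set. -/
def FinitelySupported {X : Type*} (f : L2 X) : Prop := {x | f x ≠ 0}.Finite

/-- A symmetric stochastic matrix indexed by `X`. -/
structure IsSymmStochastic {X : Type*} (k : X → X → ℝ) : Prop where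
  nonneg : ∀ x y, 0 ≤ k x y
  symm : ∀ x y, k x y = k y x
  hasSum : ∀ x, HasSum (k x) 1

section Markov

variable {X : Type*} {k : X → X → ℝ}

theorem IsSymmStochastic.le_one (hk : IsSymmStochastic k) (x y : X) : k x y ≤ 1 :=
  le_hasSum (hk.hasSum x) y (fun z _ => hk.nonneg x z)

theorem summable_sq (f : L2 X) : Summable fun y => ‖f y‖ ^ 2 := by
  have h := (lp.memℓp f).summable (by norm_num)
  simpa using h

theorem norm_sq_eq (f : L2 X) : ‖f‖ ^ 2 = ∑' y, ‖f y‖ ^ 2 := by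
  have h := lp.norm_rpow_eq_tsum (p := 2) (by norm_num) f
  simpa using h

theorem IsSymmStochastic.summable_mul_sq (hk : IsSymmStochastic k) (x : X) (f : L2 X) :
    Summable fun y => k x y * ‖f y‖ ^ 2 :=
  Summable.of_nonneg_of_le (fun y => mul_nonneg (hk.nonneg x y) (sq_nonneg _))
    (fun y => mul_le_of_le_one_left (sq_nonneg _) (hk.le_one x y)) (summable_sq f)

theorem IsSymmStochastic.summable_mul_norm (hk : IsSymmStochastic k) (x : X) (f : L2 X) :
    Summable fun y => k x y * ‖f y‖ := by
  refine Summable.of_nonneg_of_le (fun y => mul_nonneg (hk.nonneg x y) (norm_nonneg _))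
    (fun y => ?_) ((hk.hasSum x).summable.add (hk.summable_mul_sq x f))
  nlinarith [hk.nonneg x y, sq_nonneg (‖f y‖ - 1), mul_nonneg (hk.nonneg x y)
    (sq_nonneg (‖f y‖ - 1)), mul_nonneg (hk.nonneg x y) (norm_nonneg (f y))]

theorem IsSymmStochastic.summable_mul (hk : IsSymmStochastic k) (x : X) (f : L2 X) :
    Summable fun y => (k x y : ℂ) * f y := by
  refine Summable.of_norm_bounded (hk.summable_mul_norm x f) (fun y => ?_)
  rw [norm_mul, Complex.norm_real, Real.norm_of_nonneg (hk.nonneg x y)]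

theorem IsSymmStochastic.norm_tsum_sq_le (hk : IsSymmStochastic k) (x : X) (f : L2 X) :
    ‖∑' y, (k x y : ℂ) * f y‖ ^ 2 ≤ ∑' y, k x y * ‖f y‖ ^ 2 := by
  have h1 : ‖∑' y, (k x y : ℂ) * f y‖ ≤ ∑' y, k x y * ‖f y‖ := by
    refine tsum_of_norm_bounded (hk.summable_mul_norm x f).hasSum (fun y => ?_)
    rw [norm_mul, Complex.norm_real, Real.norm_of_nonneg (hk.nonneg x y)]
  set S := ∑' y, k x y * ‖f y‖ with hS
  have h2 : HasSum (fun y => k x y * (‖f y‖ - S) ^ 2)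
      (∑' y, k x y * ‖f y‖ ^ 2 - 2 * S * S + S ^ 2 * 1) := by
    have := ((hk.summable_mul_sq x f).hasSum.sub
      ((hk.summable_mul_norm x f).hasSum.mul_left (2 * S))).add ((hk.hasSum x).mul_left (S ^ 2))
    have he : (fun y => k x y * (‖f y‖ - S) ^ 2) =
        fun y => k x y * ‖f y‖ ^ 2 - 2 * S * (k x y * ‖f y‖) + S ^ 2 * k x y := by
      ext y
      ring
    rw [he]
    exact this
  have h3 := h2.nonneg (fun y => mul_nonneg (hk.nonneg x y) (sq_nonneg _))
  have h4 : ‖∑' y, (k x y : ℂ) * f y‖ ^ 2 ≤ S ^ 2 := by gcongr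
  nlinarith

theorem IsSymmStochastic.sum_le (hk : IsSymmStochastic k) (f : L2 X) (s : Finset X) :
    ∑ x ∈ s, ‖∑' y, (k x y : ℂ) * f y‖ ^ 2 ≤ ‖f‖ ^ 2 := by
  calc ∑ x ∈ s, ‖∑' y, (k x y : ℂ) * f y‖ ^ 2
      ≤ ∑ x ∈ s, ∑' y, k x y * ‖f y‖ ^ 2 := Finset.sum_le_sum fun x _ => hk.norm_tsum_sq_le x f
    _ = ∑' y, ∑ x ∈ s, k x y * ‖f y‖ ^ 2 :=
        (Summable.tsum_finsetSum fun x _ => hk.summable_mul_sq x f).symm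
    _ ≤ ∑' y, ‖f y‖ ^ 2 := by
        refine Summable.tsum_le_tsum (fun y => ?_)
          (summable_sum fun x _ => hk.summable_mul_sq x f) (summable_sq f)
        rw [← Finset.sum_mul]
        refine mul_le_of_le_one_left (sq_nonneg _) ?_
        simp_rw [hk.symm _ y]
        exact sum_le_hasSum s (fun z _ => hk.nonneg y z) (hk.hasSum y)
    _ = ‖f‖ ^ 2 := (norm_sq_eq f).symm

/-- The bounded operator `f ↦ (x ↦ ∑ y, k x y * f y)` on square summable functions. -/
def markovOp (k : X → X → ℝ) (hk : IsSymmStochastic k) : L2 X →L[ℂ] L2 X :=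
  LinearMap.mkContinuous
    { toFun := fun f => ⟨fun x => ∑' y, (k x y : ℂ) * f y,
        memℓp_gen' (C := ‖f‖ ^ 2) fun s => by simpa using hk.sum_le f s⟩
      map_add' := fun f g => by
        ext x
        change ∑' y, (k x y : ℂ) * (f y + g y) = (∑' y, (k x y : ℂ) * f y) + ∑' y, (k x y : ℂ) * g y
        simp_rw [mul_add]
        exact (hk.summable_mul x f).tsum_add (hk.summable_mul x g)
      map_smul' := fun c f => by
        ext x
        change ∑' y, (k x y : ℂ) * (c * f y) = c * ∑' y, (k x y : ℂ) * f y
        rw [← tsum_mul_left]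
        exact tsum_congr fun y => by ring }
    1 (fun f => by
      refine lp.norm_le_of_forall_sum_le (by norm_num) (by positivity) fun s => ?_
      simpa using hk.sum_le f s)

theorem markovOp_apply (hk : IsSymmStochastic k) (f : L2 X) (x : X) :
    markovOp k hk f x = ∑' y, (k x y : ℂ) * f y := rfl

end Markov

/-- The elementary tensor `φ ⊗ f`, as a function on the product. -/
def tensor {X Y : Type*} (φ : L2 X) (f : L2 Y) : L2 (X × Y) :=
  ⟨fun q => φ q.1 * f q.2, by
    refine memℓp_gen ?_
    have h := (summable_sq φ).mul_of_nonneg (summable_sq f)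
      (fun _ => sq_nonneg _) (fun _ => sq_nonneg _)
    simpa [mul_pow] using h⟩

/-! ### Nearest neighbour walks and lamplighter walks -/

/-- Transition probabilities of a nearest neighbour random walk on `G`. -/
structure IsNearestNeighbourWalk {V : Type*} (G : SimpleGraph V) (p : V → V → ℝ) : Prop where
  nonneg : ∀ x y, 0 ≤ p x y
  eq_zero : ∀ x y, ¬ G.Adj x y → p x y = 0
  hasSum : ∀ x, HasSum (p x) 1

/-- `p` is a nearest neighbour random walk on `G` whose transition operator is selfadjoint with
respect to the counting measure, that is, whose matrix is symmetric. -/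
structure IsSelfAdjointWalk {V : Type*} (G : SimpleGraph V) (p : V → V → ℝ) : Prop
    extends IsNearestNeighbourWalk G p where
  symm : ∀ x y, p x y = p y x

theorem IsSelfAdjointWalk.isSymmStochastic {V : Type*} {G : SimpleGraph V} {p : V → V → ℝ}
    (hp : IsSelfAdjointWalk G p) : IsSymmStochastic p :=
  ⟨hp.nonneg, hp.symm, hp.hasSum⟩

/-- The transition operator `T` of the walk. -/
def transitionOp {V : Type*} {G : SimpleGraph V} (p : V → V → ℝ) (hp : IsSelfAdjointWalk G p) :
    L2 V →L[ℂ] L2 V :=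
  markovOp p hp.isSymmStochastic

/-- Lamp configurations: functions `V → H` that are off (equal to `0`) at all but finitely many
vertices. -/
abbrev Config (V H : Type*) [Zero H] := V →₀ H

section Lamps

variable {V H : Type*} [Zero H] [Fintype H]

/-- The number of configurations agreeing with `ξ` off `S` is `|H| ^ |S|`. -/
theorem hasSum_agreeOff (S : Finset V) (ξ : Config V H) (c : ℝ) [DecidablePred
      fun η : Config V H => ∀ z, z ∉ S → η z = ξ z] :
    HasSum (fun η : Config V H => if ∀ z, z ∉ S → η z = ξ z then c else 0)
      ((Fintype.card H : ℝ) ^ S.card * c) := by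
  classical
  let F : (S → H) → Config V H := fun g =>
    Finsupp.onFinset (ξ.support ∪ S) (fun z => if h : z ∈ S then g ⟨z, h⟩ else ξ z) (by
      intro z hz
      by_cases h : z ∈ S
      · simp [h]
      · simp only [h, dite_false] at hz
        simp [hz])
  have hF1 : ∀ g z, z ∉ S → F g z = ξ z := fun g z hz => by simp [F, hz]
  have hinj : Function.Injective F := by
    intro g g' h
    ext ⟨z, hz⟩
    have := DFunLike.congr_fun h z
    simpa [F, hz] using this
  rw [← hinj.hasSum_iff]
  · have := hasSum_fintype fun _ : S → H => c
    convert this using 1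
    · ext g
      simp only [Function.comp]
      rw [if_pos (hF1 g)]
    · simp
  · intro η hη
    rw [if_neg]
    intro h
    apply hη
    refine ⟨fun z => η z, ?_⟩
    ext z
    by_cases hz : z ∈ S
    · simp [F, hz]
    · exact (hF1 (fun z : S => η z) z hz).trans (h z hz).symm

open Classical in
/-- Transition probabilities of the switch-walk-switch lamplighter walk. -/
def lampKernel (G : SimpleGraph V) (p : V → V → ℝ) (a b : Config V H × V) : ℝ :=
  if G.Adj a.2 b.2 ∧ ∀ z, z ≠ a.2 → z ≠ b.2 → a.1 z = b.1 z
  then p a.2 b.2 / (Fintype.card H : ℝ) ^ 2 else 0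

theorem card_ne_zero : (Fintype.card H : ℝ) ≠ 0 := by
  have : Nonempty H := ⟨0⟩
  exact_mod_cast Fintype.card_ne_zero

theorem isSymmStochastic_lampKernel {G : SimpleGraph V} {p : V → V → ℝ}
    (hp : IsSelfAdjointWalk G p) : IsSymmStochastic (lampKernel (H := H) G p) where
  nonneg a b := by
    unfold lampKernel
    split_ifs
    · exact div_nonneg (hp.nonneg _ _) (by positivity)
    · exact le_rfl
  symm a b := by
    classical
    have h : (G.Adj a.2 b.2 ∧ ∀ z, z ≠ a.2 → z ≠ b.2 → a.1 z = b.1 z) ↔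
        (G.Adj b.2 a.2 ∧ ∀ z, z ≠ b.2 → z ≠ a.2 → b.1 z = a.1 z) :=
      ⟨fun h => ⟨h.1.symm, fun z h1 h2 => (h.2 z h2 h1).symm⟩,
        fun h => ⟨h.1.symm, fun z h1 h2 => (h.2 z h2 h1).symm⟩⟩
    simp only [lampKernel, h, hp.symm a.2 b.2]
  hasSum a := by
    classical
    obtain ⟨ξ, x⟩ := a
    have hnn : ∀ b, 0 ≤ lampKernel G p (ξ, x) b := by
      intro b
      unfold lampKernel
      split_ifs
      · exact div_nonneg (hp.nonneg _ _) (by positivity)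
      · exact le_rfl
    have hrow : ∀ y, HasSum (fun η : Config V H => lampKernel G p (ξ, x) (η, y)) (p x y) := by
      intro y
      by_cases hxy : G.Adj x y
      · have h := hasSum_agreeOff {x, y} ξ (p x y / (Fintype.card H : ℝ) ^ 2)
        rw [Finset.card_pair hxy.ne, mul_div_cancel₀ _ (pow_ne_zero 2 card_ne_zero)] at h
        have he : (fun η : Config V H => lampKernel G p (ξ, x) (η, y)) = fun η =>
            if ∀ z, z ∉ ({x, y} : Finset V) → η z = ξ z
            then p x y / (Fintype.card H : ℝ) ^ 2 else 0 := by
          ext η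
          unfold lampKernel
          refine if_congr ⟨fun h z hz => ?_, fun h => ⟨hxy, fun z h1 h2 => ?_⟩⟩ rfl rfl
          · simp only [Finset.mem_insert, Finset.mem_singleton, not_or] at hz
            exact (h.2 z hz.1 hz.2).symm
          · exact (h z (by simp [h1, h2])).symm
        rw [he]
        exact h
      · rw [hp.eq_zero x y hxy]
        have he : (fun η : Config V H => lampKernel G p (ξ, x) (η, y)) = fun _ => 0 := by
          ext η
          simp [lampKernel, hxy]
        rw [he]
        exact hasSum_zero
    have hs : Summable fun q : V × Config V H => lampKernel G p (ξ, x) (q.2, q.1) := by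
      rw [summable_prod_of_nonneg fun q => hnn _]
      exact ⟨fun y => (hrow y).summable, by
        simp_rw [(hrow _).tsum_eq]
        exact (hp.hasSum x).summable⟩
    have h1 : HasSum (fun q : V × Config V H => lampKernel G p (ξ, x) (q.2, q.1)) 1 := by
      have h2 := hs.hasSum.prod_fiberwise hrow
      rw [← h2.unique (hp.hasSum x)]
      exact hs.hasSum
    exact (Equiv.prodComm V (Config V H)).hasSum_iff.mp h1

/-- The lamplighter transition operator `T̃`. -/
def lampOp {G : SimpleGraph V} (p : V → V → ℝ) (hp : IsSelfAdjointWalk G p) :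
    L2 (Config V H × V) →L[ℂ] L2 (Config V H × V) :=
  markovOp (lampKernel G p) (isSymmStochastic_lampKernel hp)

/-! ### The averaging operators and the projections they generate -/

open Classical in
/-- The matrix averaging over the lamp at `x`. -/
def avgKernel (x : V) (ξ η : Config V H) : ℝ :=
  if ∀ z, z ≠ x → ξ z = η z then (Fintype.card H : ℝ)⁻¹ else 0

theorem isSymmStochastic_avgKernel (x : V) :
    IsSymmStochastic (avgKernel (H := H) x) where
  nonneg ξ η := by
    unfold avgKernel
    split_ifs <;> positivity
  symm ξ η := by
    have h : (∀ z, z ≠ x → ξ z = η z) ↔ (∀ z, z ≠ x → η z = ξ z) :=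
      ⟨fun h z hz => (h z hz).symm, fun h z hz => (h z hz).symm⟩
    classical
    unfold avgKernel
    exact if_congr h rfl rfl
  hasSum ξ := by
    classical
    have h := hasSum_agreeOff {x} ξ (Fintype.card H : ℝ)⁻¹
    rw [Finset.card_singleton, pow_one, mul_inv_cancel₀ card_ne_zero] at h
    have he : avgKernel x ξ = fun η : Config V H =>
        if ∀ z, z ∉ ({x} : Finset V) → η z = ξ z then (Fintype.card H : ℝ)⁻¹ else 0 := by
      ext η
      unfold avgKernel
      refine if_congr ⟨fun h z hz => (h z (by simpa using hz)).symm,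
        fun h z hz => (h z (by simpa using hz)).symm⟩ rfl rfl
    rw [he]
    exact h

/-- The averaging operator `Θ_x`: the mean of `f` over the `|H|` configurations that agree with the
given one off `x`. -/
def avgOp (x : V) : L2 (Config V H) →L[ℂ] L2 (Config V H) :=
  markovOp (avgKernel x) (isSymmStochastic_avgKernel x)

theorem avgOp_apply (x : V) (f : L2 (Config V H)) (ξ : Config V H) :
    avgOp x f ξ = (Fintype.card H : ℂ)⁻¹ * ∑ h : H, f (ξ.update x h) := by
  classical
  have hinj : Function.Injective fun h : H => ξ.update x h := by
    intro h h' e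
    simpa using DFunLike.congr_fun e x
  change ∑' η, (avgKernel x ξ η : ℂ) * f η = _
  rw [← hinj.tsum_eq, tsum_fintype, Finset.mul_sum]
  · refine Finset.sum_congr rfl fun h _ => ?_
    have : ∀ z, z ≠ x → ξ z = ξ.update x h z := by
      intro z hz
      simp [Finsupp.update, Function.update_of_ne hz]
    simp only [avgKernel, if_pos this]
    push_cast
    rfl
  · intro η hη
    refine ⟨η x, ?_⟩
    by_contra hne
    apply hη
    have : ¬ ∀ z, z ≠ x → ξ z = η z := by
      intro hz
      apply hne
      ext z
      by_cases hzx : z = x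
      · subst hzx
        simp
      · simp [Finsupp.update, Function.update_of_ne hzx, hz z hzx]
    simp only [avgKernel, if_neg this]
    simp

theorem commute_avgOp (x y : V) : Commute (avgOp (H := H) x) (avgOp y) := by
  classical
  rcases eq_or_ne x y with rfl | hxy
  · exact Commute.refl _
  ext f ξ
  change avgOp x (avgOp y f) ξ = avgOp y (avgOp x f) ξ
  simp only [avgOp_apply]
  simp_rw [← Finset.mul_sum]
  rw [Finset.sum_comm]
  congr 2
  refine Finset.sum_congr rfl fun h _ => Finset.sum_congr rfl fun h' _ => ?_
  have he : (ξ.update x h').update y h = (ξ.update y h).update x h' := by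
    ext z
    simp only [Finsupp.coe_update]
    rw [Function.update_comm hxy]
  rw [he]

/-- The vertex boundary `dA`. -/
def vertexBoundary (G : SimpleGraph V) (A : Set V) : Set V :=
  {y | y ∉ A ∧ ∃ x ∈ A, G.Adj y x}

open Classical in
/-- The projection `Θ_{A,dA} = ∏_{x ∈ A} Θ_x ∏_{y ∈ dA} (1 - Θ_y)`. If `dA` is infinite, the second
product is understood as the strong limit of its finite subproducts, which is `0` when there are at
least two lamp states. -/
def clusterProj (G : SimpleGraph V) (A : Finset V) : L2 (Config V H) →L[ℂ] L2 (Config V H) :=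
  if hA : (vertexBoundary G (A : Set V)).Finite then
    A.noncommProd (fun x => avgOp x) (fun x _ y _ _ => commute_avgOp x y) *
      hA.toFinset.noncommProd (fun y => 1 - avgOp y)
        (fun x _ y _ _ => ((Commute.one_left _).sub_left ((Commute.one_right _).sub_right
          (commute_avgOp x y))))
  else 0

end Lamps

/-- The orthogonal projection `P_A` of `L2 V` onto the functions supported in `A`. -/
def restrictProj {V : Type*} (A : Finset V) : L2 V →L[ℂ] L2 V :=
  ∑ x ∈ A, InnerProductSpace.rankOne ℂ (basisVec x) (basisVec x)

/-- The truncation `T_A = P_A T P_A`. -/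
def truncatedOp {V : Type*} {G : SimpleGraph V} (p : V → V → ℝ) (hp : IsSelfAdjointWalk G p)
    (A : Finset V) : L2 V →L[ℂ] L2 V :=
  restrictProj A ∘L transitionOp p hp ∘L restrictProj A

/-! ### Site percolation -/

/-- The open cluster of `x` when `ω` is the set of open vertices; it is empty if `x` is closed. -/
def cluster {V : Type*} (G : SimpleGraph V) (ω : Set V) (x : V) : Set V :=
  {y | ∃ (hx : x ∈ ω) (hy : y ∈ ω), (G.induce ω).Reachable ⟨x, hx⟩ ⟨y, hy⟩}

/-- The critical parameter of Bernoulli site percolation on `G`: the infimum of all `q ∈ [0, 1]` for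
which some cluster is infinite with positive probability, and `1` if there is no such `q`. -/
def criticalProbability {V : Type*} (G : SimpleGraph V) : unitInterval :=
  sInf {q | ∃ x, 0 < ProbabilityTheory.setBernoulli Set.univ q {ω | (cluster G ω x).Infinite}}

/-! ### Pure point spectrum -/

section Spectral

variable {E : Type*} [NormedAddCommGroup E] [InnerProductSpace ℂ E]

/-- `μ` is the spectral measure `⟨dE(t) f, f⟩` of the bounded operator `T` at `f`: the finite measure
on the line of bounded support whose moments are `⟨T ^ n f, f⟩`. -/
def IsSpectralMeasure (T : E →L[ℂ] E) (f : E) (μ : MeasureTheory.Measure ℝ) : Prop :=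
  MeasureTheory.IsFiniteMeasure μ ∧ (∃ R : ℝ, μ (Set.Icc (-R) R)ᶜ = 0) ∧
    ∀ n : ℕ, ((∫ t, t ^ n ∂μ : ℝ) : ℂ) = inner ℂ f ((T ^ n) f)

/-- The spectrum of `T` is pure point: every vector has a spectral measure, and it is concentrated on
a countable set. -/
def HasPurePointSpectrum (T : E →L[ℂ] E) : Prop :=
  ∀ f : E, ∃ μ, IsSpectralMeasure T f μ ∧ ∃ S : Set ℝ, S.Countable ∧ μ Sᶜ = 0

/-- A complete orthonormal system. -/
def IsCompleteOrthonormal {ι : Type*} (v : ι → E) : Prop :=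
  Orthonormal ℂ v ∧ (Submodule.span ℂ (Set.range v)).topologicalClosure = ⊤

end Spectral

/-! ### The system of eigenfunctions -/

/-- The finite connected sets of vertices. -/
abbrev Animal {V : Type*} (G : SimpleGraph V) := {A : Finset V // (G.induce (A : Set V)).Connected}

/-- `f` is an orthonormal basis of `ℓ²(A)`, made of eigenvectors of `T_A` with eigenvalues `ev`. -/
def IsTruncatedEigenbasis {V : Type*} {G : SimpleGraph V} (p : V → V → ℝ)
    (hp : IsSelfAdjointWalk G p) (A : Finset V) (f : A → L2 V) (ev : A → ℝ) : Prop :=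
  Orthonormal ℂ f ∧ Submodule.span ℂ (Set.range f) = (restrictProj A).range ∧
    ∀ a, truncatedOp p hp A (f a) = (ev a : ℂ) • f a

section System

variable {V H : Type*} [Zero H] [Fintype H]

/-- The normalized Gram-Schmidt process applied to the sequence `P e_{η 0}, P e_{η 1}, …`; entries
depending linearly on earlier ones yield `0`. -/
def gramSchmidtSeq (P : L2 (Config V H) →L[ℂ] L2 (Config V H)) (enum : ℕ → Config V H) (n : ℕ) :
    L2 (Config V H) :=
  InnerProductSpace.gramSchmidtNormed ℂ (fun j => P (basisVec (enum j))) n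

/-- The indices of the vectors that the Gram-Schmidt process keeps. -/
abbrev GSIndex (P : L2 (Config V H) →L[ℂ] L2 (Config V H)) (enum : ℕ → Config V H) :=
  {n : ℕ // gramSchmidtSeq P enum n ≠ 0}

/-- The Gram-Schmidt vectors form an orthonormal basis of the range of `P`, made of finitely
supported functions. -/
def IsFinitelySupportedGSBasis (P : L2 (Config V H) →L[ℂ] L2 (Config V H))
    (enum : ℕ → Config V H) : Prop :=
  Orthonormal ℂ (fun i : GSIndex P enum => gramSchmidtSeq P enum i) ∧
    (Submodule.span ℂ (Set.range fun i : GSIndex P enum =>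
      gramSchmidtSeq P enum i)).topologicalClosure = P.range ∧
    ∀ i : GSIndex P enum, FinitelySupported (gramSchmidtSeq P enum i)

/-- Index set of the eigenfunctions: triples `(A, i, a)` with `A` finite connected and `a ∈ A`, and
pairs `(x, i)` with `x` a vertex, `i` running over a Gram-Schmidt basis of the range of `Θ_{A,dA}`,
respectively of `1 - Θ_x`. -/
abbrev EigenIndex (G : SimpleGraph V) (enum : ℕ → Config V H) :=
  (Σ A : Animal G, GSIndex (clusterProj G A.1) enum × A.1) ⊕
    (Σ x : V, GSIndex (1 - avgOp x) enum)

/-- The functions `φ_{A,i} ⊗ f_{A,a}` and `ψ_{x,i} ⊗ e_x`. -/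
def eigenSystem (G : SimpleGraph V) (enum : ℕ → Config V H) (f : ∀ A : Animal G, A.1 → L2 V) :
    EigenIndex G enum → L2 (Config V H × V)
  | .inl ⟨A, i, a⟩ => tensor (gramSchmidtSeq (clusterProj G A.1) enum i) (f A a)
  | .inr ⟨x, i⟩ => tensor (gramSchmidtSeq (1 - avgOp x) enum i) (basisVec x)

/-- The eigenvalue of `φ_{A,i} ⊗ f_{A,a}` is that of `f_{A,a}`, the one of `ψ_{x,i} ⊗ e_x` is `0`. -/
def eigenValue (G : SimpleGraph V) (enum : ℕ → Config V H) (ev : ∀ A : Animal G, A.1 → ℝ) :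
    EigenIndex G enum → ℝ
  | .inl ⟨A, _, a⟩ => ev A a
  | .inr _ => 0

end System

end

end Lamplighter

open Lamplighter

/-!
The averaging operators `Θ_x` are commuting orthogonal projections, and the lamplighter operator is
`T̃ = ∑ p(x, y) Θ_x Θ_y ⊗ E_{xy}` with the matrix units `E_{xy}` (`lampOp_tensor_basisVec`). If `φ`
is in the range of `Θ_{A,dA}`, then `Θ_x φ = φ` for `x ∈ A` and `Θ_y φ = 0` for `y ∈ dA`; since a
nearest neighbour step out of `A` ends in `dA`, this gives `T̃ (φ ⊗ f) = φ ⊗ T_A f` for `f` supported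
in `A` (`lampOp_tensor`), so that eigenvectors of the finite matrices `T_A` yield eigenfunctions of
`T̃`. Similarly `T̃` annihilates `ψ ⊗ e_x` if `Θ_x ψ = 0`.

For orthogonality, of two different finite connected sets with a common vertex, one contains a vertex
`z` of the boundary of the other. Then `Θ_z` fixes the range of the first projection and annihilates
that of the second, so the two ranges are orthogonal (`inner_eq_zero_of_mem_range_clusterProj`). If
the sets are disjoint, the factors in `ℓ²(V)` have disjoint supports.

Completeness is where percolation enters. By inclusion-exclusion the diagonal matrix entries of
`Θ_{A,dA}` at every configuration equal `q ^ |A| (1 - q) ^ |dA|` with `q = 1 / |H|`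
(`inner_basisVec_clusterProj`), which is the probability that `A` is the cluster of a given vertex
`x ∈ A` in Bernoulli site percolation with parameter `q`; likewise the entries of `1 - Θ_x` are
`1 - q`, the probability that `x` is closed. For `q < p_c` the cluster of `x` is almost surely finite,
so these probabilities sum up to `1` (`one_le_tsum_clusterWeight`). Hence the squared norms of the
components of `e_ξ` in the mutually orthogonal ranges of `1 - Θ_x` and of `Θ_{A,dA}`, `A ∋ x`, add up
to `‖e_ξ‖²`, and `e_ξ` lies in the closed space generated by these ranges
(`basisVec_mem_of_subcritical`). Tensoring with `e_x`, which is a combination of the eigenvectors of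
`T_A` for each `A ∋ x`, gives all basis vectors of the product.

Finally, a complete orthonormal system of eigenvectors `v_i` represents the spectral measure at `f` as
the sum of the point masses `|⟨v_i, f⟩|²` at the eigenvalues
(`IsCompleteOrthonormal.hasPurePointSpectrum`).
-/

namespace Lamplighter

/-! ### Basis vectors, finitely supported functions and tensors -/

section Basics

variable {X Y : Type*}

theorem basisVec_eq_single [DecidableEq X] (x : X) : basisVec x = lp.single 2 x (1 : ℂ) := by
  unfold basisVec
  congr!

theorem basisVec_apply [DecidableEq X] (x y : X) : basisVec x y = if y = x then (1 : ℂ) else 0 := by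
  rw [basisVec_eq_single, lp.single_apply]
  by_cases h : y = x
  · subst h; simp
  · simp [h]

theorem inner_basisVec (x : X) (f : L2 X) : inner ℂ (basisVec x) f = f x := by
  classical
  rw [basisVec_eq_single, lp.inner_single_left]
  simp

theorem inner_basisVec_right (x : X) (f : L2 X) :
    inner ℂ f (basisVec x) = (starRingEnd ℂ) (f x) := by
  rw [← inner_conj_symm, inner_basisVec]

theorem norm_basisVec (x : X) : ‖(basisVec x : L2 X)‖ = 1 := by
  classical
  rw [basisVec_eq_single, lp.norm_single (by norm_num)]
  simp

theorem orthonormal_basisVec : Orthonormal ℂ (basisVec : X → L2 X) := by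
  classical
  refine ⟨norm_basisVec, fun x y hxy => ?_⟩
  change inner ℂ (basisVec x) (basisVec y) = 0
  rw [inner_basisVec, basisVec_apply, if_neg hxy]

/-- A closed subspace containing the standard basis is everything. -/
theorem eq_top_of_basisVec_mem {K : Submodule ℂ (L2 X)} (hK : IsClosed (K : Set (L2 X)))
    (h : ∀ x, basisVec x ∈ K) : K = ⊤ := by
  classical
  refine (Submodule.eq_top_iff'.mpr fun f => ?_)
  have hs := lp.hasSum_single (p := 2) (by norm_num) f
  refine hK.mem_of_tendsto hs (Filter.Eventually.of_forall fun s => ?_)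
  refine Submodule.sum_mem _ fun x _ => ?_
  have he : lp.single 2 x (f x) = (f x) • (basisVec x : L2 X) := by
    ext y
    rw [lp.coeFn_smul, Pi.smul_apply, basisVec_apply, lp.single_apply]
    by_cases hy : y = x
    · subst hy; simp
    · simp [hy]
  rw [he]
  exact K.smul_mem _ (h x)

theorem IsSymmStochastic.markovOp_basisVec {k : X → X → ℝ} (hk : IsSymmStochastic k) (x y : X) :
    markovOp k hk (basisVec y) x = k x y := by
  classical
  rw [markovOp_apply, tsum_eq_single y]
  · simp [basisVec_apply]
  · intro z hz
    simp [basisVec_apply, hz]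

theorem IsSymmStochastic.isSelfAdjoint_markovOp {k : X → X → ℝ} (hk : IsSymmStochastic k) :
    IsSelfAdjoint (markovOp k hk) := by
  rw [ContinuousLinearMap.isSelfAdjoint_iff']
  ext f x
  rw [← inner_basisVec, ContinuousLinearMap.adjoint_inner_right, lp.inner_eq_tsum, markovOp_apply]
  refine tsum_congr fun y => ?_
  rw [hk.markovOp_basisVec, hk.symm y x]
  simp [mul_comm]

theorem IsSymmStochastic.inner_markovOp {k : X → X → ℝ} (hk : IsSymmStochastic k) (f g : L2 X) :
    inner ℂ (markovOp k hk f) g = inner ℂ f (markovOp k hk g) := by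
  have h := hk.isSelfAdjoint_markovOp
  rw [ContinuousLinearMap.isSelfAdjoint_iff'] at h
  conv_lhs => rw [← h]
  rw [ContinuousLinearMap.adjoint_inner_left]

theorem finitelySupported_basisVec (x : X) : FinitelySupported (basisVec x) := by
  classical
  refine (Set.finite_singleton x).subset fun y hy => ?_
  by_contra hne
  exact hy (by rw [basisVec_apply, if_neg (Set.notMem_singleton_iff.mp hne)])

variable (X) in
/-- The subspace of finitely supported functions. -/
def finitelySupportedSubmodule : Submodule ℂ (L2 X) where
  carrier := {f | FinitelySupported f}
  zero_mem' := by simp [FinitelySupported]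
  add_mem' {f g} hf hg := by
    refine (Set.Finite.union hf hg).subset fun x hx => ?_
    by_contra h
    simp only [Set.mem_union, Set.mem_ofPred_eq, not_or, not_not] at h
    exact hx (by rw [lp.coeFn_add, Pi.add_apply, h.1, h.2, add_zero])
  smul_mem' c f hf := by
    refine Set.Finite.subset hf fun x hx h => hx ?_
    rw [lp.coeFn_smul, Pi.smul_apply, h, smul_zero]

theorem tensor_apply (φ : L2 X) (f : L2 Y) (q : X × Y) : tensor φ f q = φ q.1 * f q.2 := rfl

theorem tensor_basisVec (x : X) (y : Y) : tensor (basisVec x) (basisVec y) = basisVec (x, y) := by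
  classical
  ext ⟨a, b⟩
  rw [tensor_apply]
  simp only [basisVec_apply, Prod.mk.injEq]
  by_cases h1 : a = x <;> by_cases h2 : b = y <;> simp [h1, h2]

theorem FinitelySupported.tensor {φ : L2 X} {f : L2 Y} (hφ : FinitelySupported φ)
    (hf : FinitelySupported f) : FinitelySupported (tensor φ f) := by
  refine (Set.Finite.prod hφ hf).subset fun q hq => ?_
  rw [Set.mem_ofPred_eq, tensor_apply] at hq
  exact ⟨left_ne_zero_of_mul hq, right_ne_zero_of_mul hq⟩

theorem inner_tensor (φ ψ : L2 X) (f g : L2 Y) :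
    inner ℂ (tensor φ f) (tensor ψ g) = inner ℂ φ ψ * inner ℂ f g := by
  simp only [lp.inner_eq_tsum]
  have h1 := (lp.summable_inner (𝕜 := ℂ) φ ψ).norm
  have h2 := (lp.summable_inner (𝕜 := ℂ) f g).norm
  rw [tsum_mul_tsum_of_summable_norm h1 h2]
  refine tsum_congr fun q => ?_
  simp only [tensor_apply, RCLike.inner_apply, map_mul]
  ring

theorem norm_tensor (φ : L2 X) (f : L2 Y) : ‖tensor φ f‖ = ‖φ‖ * ‖f‖ := by
  have h := inner_tensor φ φ f f
  simp only [inner_self_eq_norm_sq_to_K] at h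
  have h' : ‖tensor φ f‖ ^ 2 = (‖φ‖ * ‖f‖) ^ 2 := by
    rw [mul_pow]
    exact_mod_cast h
  exact (sq_eq_sq₀ (norm_nonneg _) (by positivity)).mp h'

/-- `φ ↦ φ ⊗ f` as a bounded operator. -/
noncomputable def tensorRight (f : L2 Y) : L2 X →L[ℂ] L2 (X × Y) :=
  LinearMap.mkContinuous
    { toFun := fun φ => tensor φ f
      map_add' := fun φ ψ => by
        ext q
        exact add_mul (φ q.1) (ψ q.1) (f q.2)
      map_smul' := fun c φ => by
        ext q
        exact mul_assoc c (φ q.1) (f q.2) }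
    ‖f‖ (fun φ => (norm_tensor φ f).le.trans (mul_comm _ _).le)

/-- `f ↦ φ ⊗ f` as a bounded operator. -/
noncomputable def tensorLeft (φ : L2 X) : L2 Y →L[ℂ] L2 (X × Y) :=
  LinearMap.mkContinuous
    { toFun := fun f => tensor φ f
      map_add' := fun f g => by
        ext q
        exact mul_add (φ q.1) (f q.2) (g q.2)
      map_smul' := fun c f => by
        ext q
        exact mul_left_comm (φ q.1) c (f q.2) }
    ‖φ‖ (fun f => (norm_tensor φ f).le)

theorem tensorLeft_apply (φ : L2 X) (f : L2 Y) : tensorLeft φ f = tensor φ f := rfl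

end Basics

/-! ### Restriction to finite sets and truncations of the walk -/

section Restriction

variable {V : Type*}

theorem restrictProj_apply [DecidableEq V] (A : Finset V) (f : L2 V) (x : V) :
    restrictProj A f x = if x ∈ A then f x else 0 := by
  unfold restrictProj
  rw [_root_.sum_apply, lp.coeFn_sum, Finset.sum_apply]
  simp only [InnerProductSpace.rankOne_apply, inner_basisVec, lp.coeFn_smul, Pi.smul_apply,
    basisVec_apply, smul_eq_mul, mul_ite, mul_one, mul_zero, Finset.sum_ite_eq]

theorem restrictProj_eq_self {A : Finset V} {f : L2 V} (hf : ∀ x ∉ A, f x = 0) :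
    restrictProj A f = f := by
  classical
  ext x
  rw [restrictProj_apply]
  split_ifs with h
  · rfl
  · rw [hf x h]

theorem mem_range_restrictProj {A : Finset V} {f : L2 V} :
    f ∈ (restrictProj A).range ↔ ∀ x ∉ A, f x = 0 := by
  classical
  constructor
  · rintro ⟨g, rfl⟩ x hx
    exact (restrictProj_apply A g x).trans (if_neg hx)
  · intro h
    exact ⟨f, restrictProj_eq_self h⟩

theorem range_restrictProj (A : Finset V) :
    (restrictProj A).range = Submodule.span ℂ (Set.range fun a : A => basisVec (a : V)) := by
  classical
  apply le_antisymm
  · rintro _ ⟨f, rfl⟩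
    change restrictProj A f ∈ _
    unfold restrictProj
    rw [_root_.sum_apply]
    refine Submodule.sum_mem _ fun x hx => ?_
    rw [InnerProductSpace.rankOne_apply]
    exact Submodule.smul_mem _ _ (Submodule.subset_span ⟨⟨x, hx⟩, rfl⟩)
  · rw [Submodule.span_le]
    rintro _ ⟨a, rfl⟩
    refine mem_range_restrictProj.mpr fun x hx => ?_
    rw [basisVec_apply, if_neg]
    rintro rfl
    exact hx a.2

/-- The functions supported in `A` form a space of dimension `|A|`. -/
theorem finrank_range_restrictProj (A : Finset V) :
    Module.finrank ℂ (restrictProj A).range = A.card := by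
  rw [range_restrictProj, finrank_span_eq_card, Fintype.card_coe]
  exact (orthonormal_basisVec.comp _ Subtype.val_injective).linearIndependent

theorem inner_restrictProj (A : Finset V) (f g : L2 V) :
    inner ℂ (restrictProj A f) g = inner ℂ f (restrictProj A g) := by
  classical
  simp only [lp.inner_eq_tsum]
  refine tsum_congr fun x => ?_
  simp only [restrictProj_apply]
  split_ifs <;> simp

/-- The spectral theorem for the truncation of the walk to `A`. -/
theorem exists_isTruncatedEigenbasis {G : SimpleGraph V} {p : V → V → ℝ}
    (hp : IsSelfAdjointWalk G p) (A : Finset V) : ∃ f ev, IsTruncatedEigenbasis p hp A f ev := by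
  classical
  set W : Submodule ℂ (L2 V) := (restrictProj A).range with hW
  have hfin : FiniteDimensional ℂ W := by
    rw [hW, range_restrictProj]
    exact FiniteDimensional.span_of_finite ℂ (Set.finite_range _)
  have hsymm : (truncatedOp p hp A : L2 V →ₗ[ℂ] L2 V).IsSymmetric := fun f g => by
    change inner ℂ (restrictProj A (transitionOp p hp (restrictProj A f))) g =
      inner ℂ f (restrictProj A (transitionOp p hp (restrictProj A g)))
    rw [inner_restrictProj, ← inner_restrictProj A f]
    exact hp.isSymmStochastic.inner_markovOp _ _
  have hinv : ∀ f ∈ W, (truncatedOp p hp A : L2 V →ₗ[ℂ] L2 V) f ∈ W := fun f _ =>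
    ⟨transitionOp p hp (restrictProj A f), rfl⟩
  have hS := hsymm.restrict_invariant hinv
  have hn : Module.finrank ℂ W = A.card := finrank_range_restrictProj A
  let b := (hS.eigenvectorBasis hn).reindex A.equivFin.symm
  refine ⟨fun a => b a, fun a => hS.eigenvalues hn (A.equivFin a), ?_, ?_, fun a => ?_⟩
  · exact b.orthonormal.comp_linearIsometry W.subtypeₗᵢ
  · have h := congrArg (Submodule.map W.subtype) b.toBasis.span_eq
    rw [Submodule.map_span, Submodule.map_top, Submodule.range_subtype, ← Set.range_comp] at h
    refine Eq.trans ?_ h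
    congr 2
  · have h := congrArg (Subtype.val) (hS.apply_eigenvectorBasis hn (A.equivFin a))
    simp only [b, OrthonormalBasis.reindex_apply, Equiv.symm_symm]
    exact h

end Restriction

/-! ### Products of averaging projections -/

theorem update_apply' {V H : Type*} [Zero H] [DecidableEq V] (ξ : Config V H) (x z : V) (h : H) :
    ξ.update x h z = if z = x then h else ξ z := by
  rw [Finsupp.coe_update, Function.update_apply]

section Lamps

variable {V H : Type*} [Zero H] [Fintype H]

theorem isStarProjection_avgOp (x : V) : IsStarProjection (avgOp (H := H) x) := by
  classical
  refine ⟨?_, (isSymmStochastic_avgKernel x).isSelfAdjoint_markovOp⟩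
  ext f ξ
  change avgOp x (avgOp x f) ξ = avgOp x f ξ
  have hu : ∀ h h' : H, (ξ.update x h).update x h' = ξ.update x h' := fun h h' => by
    ext z
    simp only [update_apply']
    split_ifs <;> rfl
  rw [avgOp_apply, avgOp_apply]
  simp_rw [avgOp_apply, hu]
  have hc : (Fintype.card H : ℂ) ≠ 0 := by exact_mod_cast card_ne_zero (H := H)
  rw [Finset.sum_const, Finset.card_univ, nsmul_eq_mul, ← mul_assoc (Fintype.card H : ℂ),
    mul_inv_cancel₀ hc, one_mul]

theorem avgOp_mul_self (x : V) : avgOp (H := H) x * avgOp x = avgOp x :=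
  (isStarProjection_avgOp x).isIdempotentElem

theorem commute_avgOp_one_sub (x y : V) : Commute (avgOp (H := H) x) (1 - avgOp y) :=
  (Commute.one_right _).sub_right (commute_avgOp x y)

theorem commute_one_sub_avgOp (x y : V) : Commute (1 - avgOp (H := H) x) (1 - avgOp y) :=
  (Commute.one_left _).sub_left (commute_avgOp_one_sub x y)

/-- The product of the averaging operators `Θ_x`, `x ∈ A`. -/
noncomputable def avgProd (A : Finset V) : L2 (Config V H) →L[ℂ] L2 (Config V H) :=
  A.noncommProd (fun x => avgOp x) (fun x _ y _ _ => commute_avgOp x y)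

/-- The product of the complementary projections `1 - Θ_y`, `y ∈ B`. -/
noncomputable def coavgProd (B : Finset V) : L2 (Config V H) →L[ℂ] L2 (Config V H) :=
  B.noncommProd (fun y => 1 - avgOp y) (fun x _ y _ _ => commute_one_sub_avgOp x y)

@[simp] theorem avgProd_empty : avgProd (H := H) (∅ : Finset V) = 1 :=
  Finset.noncommProd_empty _ _

@[simp] theorem coavgProd_empty : coavgProd (H := H) (∅ : Finset V) = 1 :=
  Finset.noncommProd_empty _ _

theorem avgProd_insert [DecidableEq V] {A : Finset V} {x : V} (hx : x ∉ A) :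
    avgProd (H := H) (insert x A) = avgOp x * avgProd A :=
  Finset.noncommProd_insert_of_notMem _ _ _ _ hx

theorem coavgProd_insert [DecidableEq V] {B : Finset V} {y : V} (hy : y ∉ B) :
    coavgProd (H := H) (insert y B) = (1 - avgOp y) * coavgProd B :=
  Finset.noncommProd_insert_of_notMem _ _ _ _ hy

theorem commute_avgOp_avgProd (x : V) (A : Finset V) :
    Commute (avgOp (H := H) x) (avgProd A) :=
  Finset.noncommProd_commute _ _ _ _ fun y _ => commute_avgOp x y

theorem commute_avgOp_coavgProd (x : V) (B : Finset V) :
    Commute (avgOp (H := H) x) (coavgProd B) :=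
  Finset.noncommProd_commute _ _ _ _ fun y _ => commute_avgOp_one_sub x y

theorem commute_avgProd_coavgProd (A B : Finset V) :
    Commute (avgProd (H := H) A) (coavgProd B) :=
  Finset.noncommProd_commute _ _ _ _ fun y _ =>
    ((Commute.one_left _).sub_left (commute_avgOp_avgProd y A)).symm

theorem avgOp_mul_avgProd {A : Finset V} {x : V} (hx : x ∈ A) :
    avgOp (H := H) x * avgProd A = avgProd A := by
  classical
  rw [← Finset.insert_erase hx, avgProd_insert (Finset.notMem_erase x A), ← mul_assoc,
    avgOp_mul_self]

theorem avgOp_mul_coavgProd {B : Finset V} {y : V} (hy : y ∈ B) :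
    avgOp (H := H) y * coavgProd B = 0 := by
  classical
  rw [← Finset.insert_erase hy, coavgProd_insert (Finset.notMem_erase y B), ← mul_assoc,
    (isStarProjection_avgOp y).mul_one_sub_self, zero_mul]

theorem isStarProjection_avgProd (A : Finset V) : IsStarProjection (avgProd (H := H) A) := by
  classical
  induction A using Finset.induction_on with
  | empty => simp
  | insert x A hx ih =>
    rw [avgProd_insert hx]
    exact (isStarProjection_avgOp x).mul ih (commute_avgOp_avgProd x A)

theorem isStarProjection_coavgProd (B : Finset V) : IsStarProjection (coavgProd (H := H) B) := by
  classical
  induction B using Finset.induction_on with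
  | empty => simp
  | insert y B hy ih =>
    rw [coavgProd_insert hy]
    exact ((isStarProjection_avgOp y).one_sub).mul ih
      ((Commute.one_left _).sub_left (commute_avgOp_coavgProd y B))

theorem finitelySupported_avgOp {f : L2 (Config V H)} (hf : FinitelySupported f) (x : V) :
    FinitelySupported (avgOp x f) := by
  classical
  refine (Set.Finite.biUnion hf fun η _ => Set.finite_range fun h : H => η.update x h).subset ?_
  intro ξ hξ
  rw [Set.mem_ofPred_eq, avgOp_apply] at hξ
  obtain ⟨h, -, hh⟩ := Finset.exists_ne_zero_of_sum_ne_zero (right_ne_zero_of_mul hξ)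
  refine Set.mem_biUnion (x := ξ.update x h) hh ⟨ξ x, ?_⟩
  ext z
  simp only [update_apply']
  split_ifs with hz
  · rw [hz]
  · rfl

theorem finitelySupported_one_sub_avgOp {f : L2 (Config V H)} (hf : FinitelySupported f) (x : V) :
    FinitelySupported ((1 - avgOp x) f) :=
  (finitelySupportedSubmodule _).sub_mem hf (finitelySupported_avgOp hf x)

theorem finitelySupported_avgProd {f : L2 (Config V H)} (hf : FinitelySupported f)
    (A : Finset V) : FinitelySupported (avgProd A f) :=
  Finset.noncommProd_induction A (fun x => avgOp (H := H) x) _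
    (fun P => ∀ g, FinitelySupported g → FinitelySupported (P g))
    (fun _ _ ha hb g hg => ha _ (hb g hg)) (fun _ hg => hg)
    (fun x _ _ hg => finitelySupported_avgOp hg x) f hf

theorem finitelySupported_coavgProd {f : L2 (Config V H)} (hf : FinitelySupported f)
    (B : Finset V) : FinitelySupported (coavgProd B f) :=
  Finset.noncommProd_induction B (fun x => 1 - avgOp (H := H) x) _
    (fun P => ∀ g, FinitelySupported g → FinitelySupported (P g))
    (fun _ _ ha hb g hg => ha _ (hb g hg)) (fun _ hg => hg)
    (fun x _ _ hg => finitelySupported_one_sub_avgOp hg x) f hf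

theorem avgProd_basisVec_apply (A : Finset V) (ξ η : Config V H)
    [Decidable (∀ z, z ∉ A → η z = ξ z)] :
    avgProd A (basisVec ξ) η =
      if ∀ z, z ∉ A → η z = ξ z then ((Fintype.card H : ℂ)⁻¹) ^ A.card else 0 := by
  classical
  induction A using Finset.induction_on generalizing η with
  | empty =>
    simp only [avgProd_empty, one_apply_eq_self, basisVec_apply, Finset.notMem_empty,
      not_false_eq_true, forall_const, Finset.card_empty, pow_zero, DFunLike.ext_iff]
  | insert x A hx ih =>
    rw [avgProd_insert hx]
    change avgOp x (avgProd A (basisVec ξ)) η = _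
    rw [avgOp_apply]
    simp_rw [ih]
    have hiff : ∀ h : H, (∀ z, z ∉ A → η.update x h z = ξ z) ↔
        h = ξ x ∧ ∀ z, z ∉ insert x A → η z = ξ z := by
      intro h
      simp only [update_apply', Finset.mem_insert, not_or]
      constructor
      · intro hz
        refine ⟨by simpa using hz x hx, fun z hzz => by simpa [hzz.1] using hz z hzz.2⟩
      · rintro ⟨rfl, hz⟩ z hzA
        split_ifs with hzx
        · rw [hzx]
        · exact hz z ⟨hzx, hzA⟩
    simp_rw [hiff, ite_and]
    rw [Finset.sum_ite_eq' Finset.univ (ξ x), if_pos (Finset.mem_univ _),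
      Finset.card_insert_of_notMem hx, pow_succ']
    split_ifs <;> simp

/-- The diagonal entries of the cluster projections are the probabilities that independent
percolation with parameter `1 / |H|` is open on `A` and closed on `B`. -/
theorem inner_basisVec_avgProd_mul_coavgProd (ξ : Config V H) (B : Finset V) :
    ∀ A : Finset V, Disjoint A B →
      inner ℂ (basisVec ξ)
          ((avgProd A * coavgProd B : L2 (Config V H) →L[ℂ] L2 (Config V H)) (basisVec ξ)) =
        ((Fintype.card H : ℂ)⁻¹) ^ A.card * (1 - (Fintype.card H : ℂ)⁻¹) ^ B.card := by
  classical
  induction B using Finset.induction_on with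
  | empty =>
    intro A _
    rw [coavgProd_empty, mul_one, inner_basisVec, avgProd_basisVec_apply, if_pos fun _ _ => rfl]
    simp
  | insert y B hy ih =>
    intro A hA
    rw [Finset.disjoint_insert_right] at hA
    -- inclusion-exclusion in the lamp at `y`
    have he : avgProd (H := H) A * coavgProd (insert y B) =
        avgProd A * coavgProd B - avgProd (insert y A) * coavgProd B := by
      rw [coavgProd_insert hy, avgProd_insert hA.1, (commute_avgOp_avgProd y A).eq, sub_mul,
        mul_sub, one_mul, mul_assoc]
    rw [he, _root_.sub_apply, inner_sub_right, ih A hA.2,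
      ih (insert y A) (Finset.disjoint_insert_left.mpr ⟨hy, hA.2⟩),
      Finset.card_insert_of_notMem hA.1, Finset.card_insert_of_notMem hy]
    ring

variable (H) in
theorem isStarProjection_clusterProj (G : SimpleGraph V) (A : Finset V) :
    IsStarProjection (clusterProj (H := H) G A) := by
  unfold clusterProj
  split_ifs with hA
  · exact ((isStarProjection_avgProd A)).mul
      (isStarProjection_coavgProd _) (commute_avgProd_coavgProd A _)
  · exact .zero _

theorem clusterProj_of_finite {G : SimpleGraph V} {A : Finset V}
    (hA : (vertexBoundary G (A : Set V)).Finite) :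
    clusterProj (H := H) G A = avgProd A * coavgProd hA.toFinset :=
  dif_pos hA

theorem avgOp_mul_clusterProj {G : SimpleGraph V} {A : Finset V} {x : V} (hx : x ∈ A) :
    avgOp x * clusterProj (H := H) G A = clusterProj G A := by
  by_cases hA : (vertexBoundary G (A : Set V)).Finite
  · rw [clusterProj_of_finite hA, ← mul_assoc, avgOp_mul_avgProd hx]
  · rw [clusterProj, dif_neg hA, mul_zero]

theorem avgOp_mul_clusterProj_eq_zero {G : SimpleGraph V} {A : Finset V} {y : V}
    (hy : y ∈ vertexBoundary G (A : Set V)) : avgOp y * clusterProj (H := H) G A = 0 := by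
  by_cases hA : (vertexBoundary G (A : Set V)).Finite
  · rw [clusterProj_of_finite hA, (commute_avgProd_coavgProd A _).eq, ← mul_assoc,
      avgOp_mul_coavgProd (hA.mem_toFinset.mpr hy), zero_mul]
  · rw [clusterProj, dif_neg hA, mul_zero]

theorem avgOp_of_mem_range_clusterProj {A : Finset V} {x : V} (hx : x ∈ A)
    {φ : L2 (Config V H)} (hφ : φ ∈ (clusterProj (H := H) G A).range) : avgOp x φ = φ := by
  obtain ⟨g, rfl⟩ := hφ
  exact DFunLike.congr_fun (avgOp_mul_clusterProj (H := H) (G := G) hx) g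

theorem avgOp_of_mem_range_clusterProj_of_boundary {A : Finset V} {x : V}
    (hx : x ∈ vertexBoundary G (A : Set V))
    {φ : L2 (Config V H)} (hφ : φ ∈ (clusterProj (H := H) G A).range) : avgOp x φ = 0 := by
  obtain ⟨g, rfl⟩ := hφ
  exact DFunLike.congr_fun (avgOp_mul_clusterProj_eq_zero (H := H) hx) g

theorem avgOp_of_mem_range_one_sub {x : V} {ψ : L2 (Config V H)}
    (hψ : ψ ∈ (1 - avgOp (H := H) x).range) : avgOp x ψ = 0 := by
  obtain ⟨g, rfl⟩ := hψ
  exact DFunLike.congr_fun (isStarProjection_avgOp x).mul_one_sub_self g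

theorem finitelySupported_clusterProj {f : L2 (Config V H)} (hf : FinitelySupported f)
    (G : SimpleGraph V) (A : Finset V) : FinitelySupported (clusterProj G A f) := by
  by_cases hA : (vertexBoundary G (A : Set V)).Finite
  · rw [clusterProj_of_finite hA]
    exact finitelySupported_avgProd (finitelySupported_coavgProd hf _) A
  · rw [clusterProj, dif_neg hA]
    exact (finitelySupportedSubmodule _).zero_mem

end Lamps

/-! ### Gram-Schmidt bases of the ranges of projections -/

section GramSchmidt

variable {V H : Type*} [Zero H]

theorem IsIdempotentElem.isClosed_range {E : Type*} [NormedAddCommGroup E] [NormedSpace ℂ E]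
    {P : E →L[ℂ] E} (hP : IsIdempotentElem P) : IsClosed (P.range : Set E) := by
  have : (P.range : Set E) = {f | P f = f} := by
    ext f
    constructor
    · rintro ⟨g, rfl⟩
      exact DFunLike.congr_fun hP g
    · exact fun h => ⟨f, h⟩
  rw [this]
  exact isClosed_eq P.continuous continuous_id

/-- The range of a bounded idempotent is closed and the images of the standard basis span a dense
subspace of it, so the Gram-Schmidt vectors form a basis of it. -/
theorem isFinitelySupportedGSBasis_of_isIdempotentElem
    {P : L2 (Config V H) →L[ℂ] L2 (Config V H)} (hP : IsIdempotentElem P)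
    (hfin : ∀ f, FinitelySupported f → FinitelySupported (P f))
    {enum : ℕ → Config V H} (henum : Function.Surjective enum) :
    IsFinitelySupportedGSBasis P enum := by
  set v : ℕ → L2 (Config V H) := fun j => P (basisVec (enum j)) with hv
  have hspan : Submodule.span ℂ (Set.range fun i : GSIndex P enum => gramSchmidtSeq P enum i) =
      Submodule.span ℂ (Set.range v) := by
    rw [← InnerProductSpace.span_gramSchmidt ℂ v,
      ← InnerProductSpace.span_gramSchmidtNormed_range (𝕜 := ℂ) v]
    apply le_antisymm
    · refine Submodule.span_mono ?_
      rintro _ ⟨i, rfl⟩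
      exact ⟨i, rfl⟩
    · rw [Submodule.span_le]
      rintro _ ⟨n, rfl⟩
      by_cases hn : gramSchmidtSeq P enum n = 0
      · change gramSchmidtSeq P enum n ∈ _
        rw [hn]
        exact Submodule.zero_mem _
      · exact Submodule.subset_span ⟨⟨n, hn⟩, rfl⟩
  refine ⟨InnerProductSpace.gramSchmidtNormed_orthonormal' v, ?_, fun i => ?_⟩
  · rw [hspan]
    apply le_antisymm
    · refine Submodule.topologicalClosure_minimal _ ?_ (IsIdempotentElem.isClosed_range hP)
      rw [Submodule.span_le]
      rintro _ ⟨n, rfl⟩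
      exact ⟨basisVec (enum n), rfl⟩
    · rintro _ ⟨f, rfl⟩
      set K := (Submodule.span ℂ (Set.range v)).topologicalClosure with hK
      have htop : K.comap (P : L2 (Config V H) →ₗ[ℂ] L2 (Config V H)) = ⊤ := by
        refine eq_top_of_basisVec_mem
          ((Submodule.isClosed_topologicalClosure _).preimage P.continuous) fun ξ => ?_
        obtain ⟨n, rfl⟩ := henum ξ
        exact Submodule.le_topologicalClosure _ (Submodule.subset_span ⟨n, rfl⟩)
      have hf : f ∈ K.comap (P : L2 (Config V H) →ₗ[ℂ] L2 (Config V H)) := htop ▸ trivial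
      exact hf
  · have hle : Submodule.span ℂ (Set.range v) ≤ finitelySupportedSubmodule _ := by
      rw [Submodule.span_le]
      rintro _ ⟨n, rfl⟩
      exact hfin _ (finitelySupported_basisVec _)
    rw [← hspan] at hle
    exact hle (Submodule.subset_span ⟨i, rfl⟩)

theorem gramSchmidtSeq_mem_range {P : L2 (Config V H) →L[ℂ] L2 (Config V H)}
    {enum : ℕ → Config V H} (h : IsFinitelySupportedGSBasis P enum) (i : GSIndex P enum) :
    gramSchmidtSeq P enum i ∈ P.range := by
  rw [← h.2.1]
  exact Submodule.le_topologicalClosure _ (Submodule.subset_span ⟨i, rfl⟩)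

end GramSchmidt

/-! ### Connected sets, clusters and percolation -/

section Percolation

variable {V : Type*} {G : SimpleGraph V}

/-- A connected set that meets `S` without being contained in it meets the boundary of `S`. -/
theorem exists_mem_vertexBoundary {C S : Set V} (hC : (G.induce C).Connected) {x a : V}
    (hxC : x ∈ C) (hxS : x ∈ S) (haC : a ∈ C) (haS : a ∉ S) : ∃ z ∈ C, z ∈ vertexBoundary G S := by
  obtain ⟨w⟩ := hC.preconnected ⟨x, hxC⟩ ⟨a, haC⟩
  obtain ⟨d, -, h1, h2⟩ := w.exists_boundary_dart (Subtype.val ⁻¹' S) hxS haS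
  exact ⟨d.snd, d.snd.2, h2, d.fst, h1, d.adj.symm⟩

/-- Of two different finite connected sets with a common point, one meets the boundary of the
other. -/
theorem exists_mem_vertexBoundary_of_ne {A B : Animal G} (hAB : A ≠ B) {x : V} (hA : x ∈ A.1)
    (hB : x ∈ B.1) : (∃ z ∈ A.1, z ∈ vertexBoundary G (B.1 : Set V)) ∨
      ∃ z ∈ B.1, z ∈ vertexBoundary G (A.1 : Set V) := by
  by_cases h : A.1 ⊆ B.1
  · right
    have hne : ¬ B.1 ⊆ A.1 := fun h' => hAB (Subtype.ext (h.antisymm h'))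
    obtain ⟨b, hb, hbA⟩ := Finset.not_subset.mp hne
    exact exists_mem_vertexBoundary B.2 hB hA hb hbA
  · left
    obtain ⟨a, ha, haB⟩ := Finset.not_subset.mp h
    exact exists_mem_vertexBoundary A.2 hA hB ha haB

theorem mem_cluster_self {ω : Set V} {x : V} (hx : x ∈ ω) : x ∈ cluster G ω x :=
  ⟨hx, hx, SimpleGraph.Reachable.refl _⟩

theorem cluster_subset (ω : Set V) (x : V) : cluster G ω x ⊆ ω := fun _ h => h.2.1

theorem notMem_of_mem_vertexBoundary_cluster {ω : Set V} {x y : V}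
    (hy : y ∈ vertexBoundary G (cluster G ω x)) : y ∉ ω := by
  obtain ⟨hyc, z, ⟨hx, hz, hr⟩, hyz⟩ := hy
  intro hyω
  refine hyc ⟨hx, hyω, hr.trans (SimpleGraph.Adj.reachable ?_)⟩
  exact hyz.symm

theorem connected_cluster {ω : Set V} {x : V} (hx : x ∈ ω) :
    (G.induce (cluster G ω x)).Connected := by
  rw [SimpleGraph.connected_iff_exists_forall_reachable]
  refine ⟨⟨x, mem_cluster_self hx⟩, ?_⟩
  rintro ⟨y, _, hy, hr⟩
  have key : ∀ z : ω, Relation.ReflTransGen (G.induce ω).Adj ⟨x, hx⟩ z →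
      ∃ hz : (z : V) ∈ cluster G ω x, (G.induce (cluster G ω x)).Reachable
        ⟨x, mem_cluster_self hx⟩ ⟨z, hz⟩ := by
    intro z hz
    induction hz with
    | refl => exact ⟨mem_cluster_self hx, SimpleGraph.Reachable.refl _⟩
    | @tail b c hb hbc ih =>
      obtain ⟨hbm, hbr⟩ := ih
      have hcm : (c : V) ∈ cluster G ω x :=
        ⟨hx, c.2, hbm.2.2.trans (SimpleGraph.Adj.reachable hbc)⟩
      refine ⟨hcm, hbr.trans (SimpleGraph.Adj.reachable ?_)⟩
      exact hbc
  exact (key ⟨y, hy⟩ ((SimpleGraph.reachable_iff_reflTransGen _ _).mp hr)).2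

open ProbabilityTheory MeasureTheory unitInterval

theorem setBernoulli_univ_cylinder (q : I) (A B : Finset V) (hAB : Disjoint A B) :
    setBernoulli Set.univ q {ω : Set V | (∀ a ∈ A, a ∈ ω) ∧ ∀ b ∈ B, b ∉ ω} =
      ENNReal.ofReal ((q : ℝ) ^ A.card * (1 - q) ^ B.card) := by
  classical
  have hq : 0 ≤ (q : ℝ) := q.2.1
  have hq' : 0 ≤ 1 - (q : ℝ) := sub_nonneg.mpr q.2.2
  have hset : (fun P : V → Prop => {i | P i}) ⁻¹'
      {ω : Set V | (∀ a ∈ A, a ∈ ω) ∧ ∀ b ∈ B, b ∉ ω} =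
      Set.pi ((A ∪ B : Finset V) : Set V) (fun i => if i ∈ A then {True} else {False}) := by
    ext P
    simp only [Set.mem_preimage, Set.mem_ofPred_eq, Set.mem_pi, Finset.mem_coe, Finset.mem_union]
    constructor
    · rintro ⟨h1, h2⟩ i hi
      split_ifs with hiA
      · simpa using h1 i hiA
      · simpa using h2 i (hi.resolve_left hiA)
    · intro h
      refine ⟨fun a ha => ?_, fun b hb => ?_⟩
      · simpa [ha] using h a (Or.inl ha)
      · simpa [Finset.disjoint_right.mp hAB hb] using h b (Or.inr hb)
  rw [setBernoulli_apply', hset, Measure.infinitePi_pi _ (fun _ _ => MeasurableSet.of_discrete),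
    Finset.prod_union hAB]
  have hT : ∀ a b : NNReal, (a • Measure.dirac True + b • Measure.dirac False) ({True} : Set Prop) =
      (a : ℝ≥0∞) := fun a b => by simp
  have hF : ∀ a b : NNReal, (a • Measure.dirac True + b • Measure.dirac False) ({False} : Set Prop) =
      (b : ℝ≥0∞) := fun a b => by simp
  have h1 : ∀ i ∈ A, (toNNReal q • Measure.dirac (i ∈ (Set.univ : Set V)) +
      toNNReal (σ q) • Measure.dirac False) (if i ∈ A then {True} else {False} : Set Prop) =
        ENNReal.ofReal q := by
    intro i hi
    rw [if_pos hi, ENNReal.ofReal_eq_coe_nnreal hq, eq_true (Set.mem_univ i)]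
    exact hT _ _
  have h2 : ∀ i ∈ B, (toNNReal q • Measure.dirac (i ∈ (Set.univ : Set V)) +
      toNNReal (σ q) • Measure.dirac False) (if i ∈ A then {True} else {False} : Set Prop) =
        ENNReal.ofReal (1 - q) := by
    intro i hi
    rw [if_neg (Finset.disjoint_right.mp hAB hi), ENNReal.ofReal_eq_coe_nnreal hq',
      eq_true (Set.mem_univ i)]
    exact hF _ _
  rw [Finset.prod_congr rfl h1, Finset.prod_congr rfl h2, Finset.prod_const, Finset.prod_const,
    ENNReal.ofReal_mul (by positivity), ENNReal.ofReal_pow hq, ENNReal.ofReal_pow hq']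

variable (G) in
open Classical in
/-- The probability that, in Bernoulli percolation with parameter `q`, all vertices of `A` are open
and all vertices of `dA` are closed. For infinite `dA` the value is set to `0`, which is this
probability if `q > 0`. -/
noncomputable def clusterWeight (q : ℝ) (A : Finset V) : ℝ :=
  if hA : (vertexBoundary G (A : Set V)).Finite then
    q ^ A.card * (1 - q) ^ hA.toFinset.card else 0

theorem disjoint_vertexBoundary {A : Finset V} (hA : (vertexBoundary G (A : Set V)).Finite) :
    Disjoint A hA.toFinset :=
  Finset.disjoint_right.mpr fun _ hy => (hA.mem_toFinset.mp hy).1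

theorem setBernoulli_cluster_eq_le {q : I} (hq : 0 < q) (A : Finset V) (x : V) :
    setBernoulli Set.univ q {ω : Set V | cluster G ω x = A} ≤
      ENNReal.ofReal (clusterWeight G q A) := by
  have hb : ∀ ω : Set V, cluster G ω x = A → ∀ b ∈ vertexBoundary G (A : Set V), b ∉ ω := by
    intro ω h b hb
    rw [← h] at hb
    exact notMem_of_mem_vertexBoundary_cluster hb
  by_cases hA : (vertexBoundary G (A : Set V)).Finite
  · rw [clusterWeight, dif_pos hA, ← setBernoulli_univ_cylinder q A _ (disjoint_vertexBoundary hA)]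
    refine measure_mono fun ω (h : cluster G ω x = A) => ⟨fun a ha => ?_, fun b hb' => ?_⟩
    · exact cluster_subset ω x (h.symm.subset (Finset.mem_coe.mpr ha))
    · exact hb ω h b (hA.mem_toFinset.mp hb')
  · rw [clusterWeight, dif_neg hA, ENNReal.ofReal_zero]
    -- an infinite boundary is closed with probability at most `(1 - q) ^ n`, for every `n`
    have hn : ∀ n : ℕ, setBernoulli Set.univ q {ω : Set V | cluster G ω x = A} ≤
        ENNReal.ofReal ((1 - q : ℝ) ^ n) := by
      intro n
      obtain ⟨B, hB, hBn⟩ := Set.Infinite.exists_subset_card_eq hA n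
      have h := setBernoulli_univ_cylinder q ∅ B (Finset.disjoint_empty_left B)
      rw [Finset.card_empty, pow_zero, one_mul, hBn] at h
      rw [← h]
      exact measure_mono fun ω h => ⟨by simp, fun b hb' => hb ω h b (hB hb')⟩
    have hq0 : (0 : ℝ) < q := hq
    have hlim : Filter.Tendsto (fun n : ℕ => ENNReal.ofReal ((1 - q : ℝ) ^ n)) Filter.atTop
        (nhds 0) := by
      rw [← ENNReal.ofReal_zero]
      exact ENNReal.tendsto_ofReal
        (tendsto_pow_atTop_nhds_zero_of_lt_one (sub_nonneg.mpr q.2.2) (by linarith))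
    exact ge_of_tendsto' hlim hn

/-- In the subcritical regime the cluster of `x` is almost surely empty or a finite connected set
containing `x`. -/
theorem one_le_tsum_clusterWeight [Countable V] {q : I} (hq : 0 < q)
    (hqc : q < criticalProbability G) (x : V) :
    1 ≤ ENNReal.ofReal (1 - q) +
      ∑' A : {A : Animal G // x ∈ A.1}, ENNReal.ofReal (clusterWeight G q A.1.1) := by
  have hinf : setBernoulli Set.univ q {ω : Set V | (cluster G ω x).Infinite} = 0 := by
    by_contra h
    exact notMem_of_lt_csInf hqc (OrderBot.bddBelow _) ⟨x, pos_iff_ne_zero.mpr h⟩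
  have hclosed : setBernoulli Set.univ q {ω : Set V | x ∉ ω} = ENNReal.ofReal (1 - q) := by
    have h := setBernoulli_univ_cylinder q ∅ {x} (Finset.disjoint_empty_left _)
    simpa using h
  have hcover : (Set.univ : Set (Set V)) ⊆ ({ω | x ∉ ω} ∪ {ω | (cluster G ω x).Infinite}) ∪
      ⋃ A : {A : Animal G // x ∈ A.1}, {ω | cluster G ω x = A.1.1} := by
    intro ω _
    by_cases hx : x ∈ ω
    · by_cases hfin : (cluster G ω x).Finite
      · right
        have hc : (hfin.toFinset : Set V) = cluster G ω x := hfin.coe_toFinset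
        refine Set.mem_iUnion.mpr ⟨⟨⟨hfin.toFinset, ?_⟩, ?_⟩, hc.symm⟩
        · rw [hc]
          exact connected_cluster hx
        · exact hfin.mem_toFinset.mpr (mem_cluster_self hx)
      · exact Or.inl (Or.inr hfin)
    · exact Or.inl (Or.inl hx)
  calc (1 : ℝ≥0∞) = setBernoulli Set.univ q (Set.univ : Set (Set V)) := measure_univ.symm
    _ ≤ _ := measure_mono hcover
    _ ≤ _ := measure_union_le _ _
    _ ≤ _ := add_le_add ((measure_union_le _ _).trans (by rw [hinf, hclosed, add_zero]))
        ((measure_iUnion_le _).trans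
          (ENNReal.tsum_le_tsum fun A => setBernoulli_cluster_eq_le hq A.1.1 x))

end Percolation

/-! ### Orthogonal decompositions and pure point spectrum -/

section Hilbert

variable {E : Type*} [NormedAddCommGroup E] [InnerProductSpace ℂ E]

/-- Parseval's identity characterizes orthogonal expansions: if the orthogonal vectors `u i` are
projections of the unit vector `y` whose square norms sum up to at least `1`, then `y` belongs to
the closed space they generate. -/
theorem mem_of_one_le_tsum_norm_sq {ι : Type*} {u : ι → E} {y : E} (hy : ‖y‖ = 1)
    (horth : ∀ i j, i ≠ j → inner ℂ (u i) (u j) = 0)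
    (hyu : ∀ i, inner ℂ y (u i) = ((‖u i‖ ^ 2 : ℝ) : ℂ))
    (hsum : 1 ≤ ∑' i, ENNReal.ofReal (‖u i‖ ^ 2)) {K : Submodule ℂ E}
    (hK : IsClosed (K : Set E)) (huK : ∀ i, u i ∈ K) : y ∈ K := by
  classical
  have hnorm : ∀ s : Finset ι, ‖y - ∑ i ∈ s, u i‖ ^ 2 = 1 - ∑ i ∈ s, ‖u i‖ ^ 2 := by
    intro s
    have h1 : inner ℂ y (∑ i ∈ s, u i) = ((∑ i ∈ s, ‖u i‖ ^ 2 : ℝ) : ℂ) := by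
      rw [inner_sum, Finset.sum_congr rfl fun i _ => hyu i]
      push_cast
      rfl
    have h2 : inner ℂ (∑ i ∈ s, u i) (∑ i ∈ s, u i) = ((∑ i ∈ s, ‖u i‖ ^ 2 : ℝ) : ℂ) := by
      rw [sum_inner]
      push_cast
      refine Finset.sum_congr rfl fun i hi => ?_
      rw [inner_sum, Finset.sum_eq_single i (fun j _ hji => horth i j hji.symm)
        (fun h => absurd hi h), inner_self_eq_norm_sq_to_K]
      rfl
    have h3 : ‖∑ i ∈ s, u i‖ ^ 2 = ∑ i ∈ s, ‖u i‖ ^ 2 := by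
      rw [inner_self_eq_norm_sq_to_K, ← RCLike.ofReal_pow] at h2
      exact Complex.ofReal_injective h2
    rw [norm_sub_sq (𝕜 := ℂ), h1, h3, hy]
    simp only [RCLike.re_to_complex, Complex.ofReal_re]
    ring
  rw [← SetLike.mem_coe, ← hK.closure_eq, Metric.mem_closure_iff]
  intro ε hε
  have hlt : ENNReal.ofReal (1 - ε ^ 2) < ∑' i, ENNReal.ofReal (‖u i‖ ^ 2) :=
    lt_of_lt_of_le ((ENNReal.ofReal_lt_one).mpr (by nlinarith)) hsum
  rw [ENNReal.tsum_eq_iSup_sum, lt_iSup_iff] at hlt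
  obtain ⟨s, hs⟩ := hlt
  rw [← ENNReal.ofReal_sum_of_nonneg fun i _ => sq_nonneg _] at hs
  have hs' := (ENNReal.ofReal_lt_ofReal_iff'.mp hs).1
  refine ⟨∑ i ∈ s, u i, K.sum_mem fun i _ => huK i, ?_⟩
  rw [dist_eq_norm]
  refine lt_of_pow_lt_pow_left₀ 2 hε.le ?_
  rw [hnorm s]
  linarith

/-- A complete orthonormal system of eigenvectors makes the spectrum pure point: the spectral
measure at `f` puts the mass `|⟨v i, f⟩|²` on the eigenvalue of `v i`. -/
theorem IsCompleteOrthonormal.hasPurePointSpectrum [CompleteSpace E] {ι : Type*} [Countable ι]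
    {v : ι → E} (hv : IsCompleteOrthonormal v) {T : E →L[ℂ] E} {ev : ι → ℝ}
    (hev : ∀ i, T (v i) = (ev i : ℂ) • v i) : HasPurePointSpectrum T := by
  intro f
  let b : HilbertBasis ι ℂ E := HilbertBasis.mk hv.1 hv.2.ge
  have hb : ∀ i, b i = v i := fun i => by rw [HilbertBasis.coe_mk]
  set c : ι → ℝ := fun i => ‖inner ℂ (v i) f‖ ^ 2 with hc
  have hc0 : ∀ i, 0 ≤ c i := fun i => sq_nonneg _
  have hbound : ∀ i, |ev i| ≤ ‖T‖ := by
    intro i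
    have h := T.le_opNorm (v i)
    rw [hev, norm_smul, hv.1.1 i, mul_one, mul_one, Complex.norm_real, Real.norm_eq_abs] at h
    exact h
  have hpow : ∀ (n : ℕ) (i : ι), (T ^ n) (v i) = ((ev i ^ n : ℝ) : ℂ) • v i := by
    intro n i
    induction n with
    | zero => simp
    | succ n ih =>
      rw [pow_succ]
      change (T ^ n) (T (v i)) = _
      rw [hev, map_smul, ih, smul_smul]
      push_cast
      rw [pow_succ']
  have hmom : ∀ n : ℕ, HasSum (fun i => ((c i * ev i ^ n : ℝ) : ℂ)) (inner ℂ f ((T ^ n) f)) := by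
    intro n
    have h := ((b.hasSum_repr f).mapL (T ^ n)).mapL (innerSL ℂ f)
    convert! h using 1
    ext i
    rw [map_smul, map_smul, b.repr_apply_apply, hb, hpow, map_smul, innerSL_apply_apply,
      smul_eq_mul, smul_eq_mul, ← inner_conj_symm f (v i), mul_left_comm, Complex.mul_conj',
      mul_comm]
    simp only [hc]
    push_cast
    rfl
  have hcs : Summable c := by
    have h := (hmom 0).summable
    simp only [pow_zero, mul_one] at h
    exact_mod_cast h
  let μ : MeasureTheory.Measure ℝ :=
    MeasureTheory.Measure.sum fun i => ENNReal.ofReal (c i) • MeasureTheory.Measure.dirac (ev i)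
  have hnull : ∀ S : Set ℝ, MeasurableSet S → (∀ i, ev i ∈ S) → μ Sᶜ = 0 := by
    intro S hS h
    rw [MeasureTheory.Measure.sum_apply _ hS.compl, ENNReal.tsum_eq_zero]
    intro i
    rw [MeasureTheory.Measure.smul_apply, MeasureTheory.Measure.dirac_apply' _ hS.compl]
    simp [h i]
  refine ⟨μ, ⟨⟨?_⟩, ⟨‖T‖, ?_⟩, fun n => ?_⟩, Set.range ev, Set.countable_range ev, ?_⟩
  · rw [MeasureTheory.Measure.sum_apply _ MeasurableSet.univ]
    simp only [MeasureTheory.Measure.smul_apply, MeasureTheory.measure_univ, smul_eq_mul, mul_one]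
    rw [← ENNReal.ofReal_tsum_of_nonneg hc0 hcs]
    exact ENNReal.ofReal_lt_top
  · exact hnull _ measurableSet_Icc fun i => abs_le.mp (hbound i)
  · have hint : ∀ i, ∫ t, t ^ n ∂(ENNReal.ofReal (c i) • MeasureTheory.Measure.dirac (ev i)) =
        c i * ev i ^ n := by
      intro i
      rw [MeasureTheory.integral_smul_measure, MeasureTheory.integral_dirac,
        ENNReal.toReal_ofReal (hc0 i), smul_eq_mul]
    have hintegrable : MeasureTheory.Integrable (fun t : ℝ => t ^ n) μ := by
      refine MeasureTheory.integrable_sum_measure (fun i => ?_) ?_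
      · exact (MeasureTheory.integrable_dirac (by finiteness)).smul_measure ENNReal.ofReal_ne_top
      · refine Summable.of_nonneg_of_le (fun i => MeasureTheory.integral_nonneg fun _ =>
          norm_nonneg _) (fun i => ?_) (hcs.mul_right (‖T‖ ^ n))
        rw [MeasureTheory.integral_smul_measure, MeasureTheory.integral_dirac,
          ENNReal.toReal_ofReal (hc0 i), smul_eq_mul, norm_pow, Real.norm_eq_abs]
        exact mul_le_mul_of_nonneg_left (pow_le_pow_left₀ (abs_nonneg _) (hbound i) n) (hc0 i)
    have h := MeasureTheory.hasSum_integral_measure hintegrable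
    simp_rw [hint] at h
    exact (Complex.hasSum_ofReal.mpr h).unique (hmom n)
  · exact hnull _ (Set.countable_range ev).measurableSet fun i => ⟨i, rfl⟩

end Hilbert

/-! ### Eigenfunctions of the lamplighter operator -/

section Eigenfunctions

variable {V H : Type*} [Zero H] [Fintype H] {G : SimpleGraph V} {p : V → V → ℝ}

open Classical in
theorem lampKernel_eq_of_adj {x y : V} (hxy : G.Adj x y) (ξ η : Config V H) :
    lampKernel G p (ξ, x) (η, y) =
      if ∀ z, z ≠ x → z ≠ y → ξ z = η z then p x y / (Fintype.card H : ℝ) ^ 2 else 0 := by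
  unfold lampKernel
  simp only [hxy, true_and]

/-- The lamplighter step from `y` to `x` randomizes the lamps at both ends. -/
theorem lampOp_tensor_basisVec (hp : IsSelfAdjointWalk G p) (φ : L2 (Config V H)) (x y : V)
    (ξ : Config V H) :
    lampOp p hp (tensor φ (basisVec y)) (ξ, x) = p x y * avgOp x (avgOp y φ) ξ := by
  classical
  change ∑' b : Config V H × V, (lampKernel G p (ξ, x) b : ℂ) * (φ b.1 * basisVec y b.2) = _
  by_cases hxy : G.Adj x y
  · have hinj : Function.Injective fun g : H × H => (((ξ.update x g.1).update y g.2, y) :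
        Config V H × V) := by
      rintro ⟨a, b⟩ ⟨a', b'⟩ h
      have h1 := (Prod.mk.inj h).1
      have hx := DFunLike.congr_fun h1 x
      have hy := DFunLike.congr_fun h1 y
      simp only [update_apply', hxy.ne, if_true, if_false] at hx hy
      rw [hx, hy]
    have hker : ∀ a b : H, lampKernel G p (ξ, x) ((ξ.update x a).update y b, y) =
        p x y / (Fintype.card H : ℝ) ^ 2 := by
      intro a b
      rw [lampKernel_eq_of_adj hxy, if_pos]
      intro z hzx hzy
      rw [update_apply', if_neg hzy, update_apply', if_neg hzx]
    rw [← hinj.tsum_eq]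
    · rw [tsum_fintype, Fintype.sum_prod_type, avgOp_apply, Finset.mul_sum, Finset.mul_sum]
      refine Finset.sum_congr rfl fun a _ => ?_
      rw [avgOp_apply, Finset.mul_sum, Finset.mul_sum, Finset.mul_sum]
      refine Finset.sum_congr rfl fun b _ => ?_
      simp only [hker, basisVec_apply, if_true]
      push_cast
      ring
    · rintro ⟨η, z⟩ hb
      rw [Function.mem_support] at hb
      have hz : z = y := by
        by_contra h
        exact hb (by simp [basisVec_apply, h])
      subst hz
      have hη : ∀ w, w ≠ x → w ≠ z → ξ w = η w := by
        by_contra h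
        exact hb (by rw [lampKernel_eq_of_adj hxy, if_neg h]; simp)
      refine ⟨(η x, η z), Prod.ext ?_ rfl⟩
      ext w
      simp only [update_apply']
      split_ifs with h1 h2
      · rw [h1]
      · rw [h2]
      · exact hη w h2 h1
  · rw [hp.eq_zero x y hxy, Complex.ofReal_zero, zero_mul]
    refine (tsum_congr fun b => ?_).trans tsum_zero
    by_cases hb : b.2 = y
    · have : lampKernel G p (ξ, x) b = 0 := by
        unfold lampKernel
        rw [if_neg]
        rintro ⟨h, -⟩
        exact hxy (hb ▸ h)
      rw [this, Complex.ofReal_zero, zero_mul]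
    · rw [basisVec_apply, if_neg hb, mul_zero, mul_zero]

theorem eq_sum_basisVec {A : Finset V} {f : L2 V} (hf : ∀ x ∉ A, f x = 0) :
    f = ∑ y ∈ A, f y • basisVec y := by
  conv_lhs => rw [← restrictProj_eq_self hf]
  unfold restrictProj
  rw [_root_.sum_apply]
  refine Finset.sum_congr rfl fun y _ => ?_
  rw [InnerProductSpace.rankOne_apply, inner_basisVec]

/-- On `Θ_{A,dA} ℓ²(ℭ) ⊗ ℓ²(A)` the lamplighter operator acts as `1 ⊗ T_A`: the lamps in `A` are
already averaged, and a step out of `A` ends in `dA`, where averaging annihilates. -/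
theorem lampOp_tensor (hp : IsSelfAdjointWalk G p) {A : Finset V} {φ : L2 (Config V H)}
    (hφ : φ ∈ (clusterProj (H := H) G A).range) {f : L2 V} (hf : ∀ x ∉ A, f x = 0) :
    lampOp p hp (tensor φ f) = tensor φ (truncatedOp p hp A f) := by
  classical
  have hin : ∀ x ∈ A, avgOp x φ = φ := fun x hx => avgOp_of_mem_range_clusterProj hx hφ
  have key : ∀ y ∈ A, lampOp p hp (tensor φ (basisVec y)) =
      tensor φ (truncatedOp p hp A (basisVec y)) := by
    intro y hy
    have hey : restrictProj A (basisVec y) = basisVec y := by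
      refine restrictProj_eq_self fun x hx => ?_
      rw [basisVec_apply, if_neg]
      rintro rfl
      exact hx hy
    ext ⟨ξ, x⟩
    have hT : truncatedOp p hp A (basisVec y) x = if x ∈ A then (p x y : ℂ) else 0 := by
      change restrictProj A (transitionOp p hp (restrictProj A (basisVec y))) x = _
      rw [hey, restrictProj_apply]
      congr 1
      exact hp.isSymmStochastic.markovOp_basisVec x y
    rw [lampOp_tensor_basisVec, hin y hy, tensor_apply, hT]
    by_cases hx : x ∈ A
    · rw [hin x hx, if_pos hx, mul_comm]
    · rw [if_neg hx, mul_zero]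
      by_cases hxy : G.Adj x y
      · rw [avgOp_of_mem_range_clusterProj_of_boundary ⟨hx, y, hy, hxy⟩ hφ]
        exact mul_zero _
      · rw [hp.eq_zero x y hxy, Complex.ofReal_zero, zero_mul]
  rw [← tensorLeft_apply, ← tensorLeft_apply, eq_sum_basisVec hf]
  simp only [map_sum, map_smul, tensorLeft_apply]
  exact Finset.sum_congr rfl fun y hy => by rw [key y hy]

theorem lampOp_tensor_basisVec_eq_zero (hp : IsSelfAdjointWalk G p) {x : V}
    {ψ : L2 (Config V H)} (hψ : ψ ∈ (1 - avgOp (H := H) x).range) :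
    lampOp p hp (tensor ψ (basisVec x)) = 0 := by
  ext ⟨ξ, z⟩
  rw [lampOp_tensor_basisVec, avgOp_of_mem_range_one_sub hψ, map_zero]
  exact mul_zero _

end Eigenfunctions

/-! ### Orthogonality and completeness -/

section System

variable {V H : Type*} [Zero H] [Fintype H] {G : SimpleGraph V}

theorem inner_avgOp (x : V) (f g : L2 (Config V H)) :
    inner ℂ (avgOp x f) g = inner ℂ f (avgOp x g) :=
  (isSymmStochastic_avgKernel x).inner_markovOp f g

theorem inner_eq_zero_of_avgOp {x : V} {φ ψ : L2 (Config V H)} (hφ : avgOp x φ = φ)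
    (hψ : avgOp x ψ = 0) : inner ℂ φ ψ = 0 := by
  rw [← hφ, inner_avgOp, hψ, inner_zero_right]

/-- Different finite connected sets with a common vertex cannot both be the percolation cluster of
that vertex; correspondingly their projections have orthogonal ranges. -/
theorem inner_eq_zero_of_mem_range_clusterProj {A B : Animal G} (hAB : A ≠ B) {x : V}
    (hA : x ∈ A.1) (hB : x ∈ B.1) {φ ψ : L2 (Config V H)}
    (hφ : φ ∈ (clusterProj (H := H) G A.1).range) (hψ : ψ ∈ (clusterProj (H := H) G B.1).range) :
    inner ℂ φ ψ = 0 := by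
  rcases exists_mem_vertexBoundary_of_ne hAB hA hB with ⟨z, hz, hzb⟩ | ⟨z, hz, hzb⟩
  · exact inner_eq_zero_of_avgOp (avgOp_of_mem_range_clusterProj hz hφ)
      (avgOp_of_mem_range_clusterProj_of_boundary hzb hψ)
  · rw [inner_eq_zero_symm]
    exact inner_eq_zero_of_avgOp (avgOp_of_mem_range_clusterProj hz hψ)
      (avgOp_of_mem_range_clusterProj_of_boundary hzb hφ)

theorem inner_basisVec_clusterProj (ξ : Config V H) (A : Finset V) :
    inner ℂ (basisVec ξ) (clusterProj G A (basisVec ξ)) =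
      (clusterWeight G (Fintype.card H : ℝ)⁻¹ A : ℂ) := by
  by_cases hA : (vertexBoundary G (A : Set V)).Finite
  · rw [clusterProj_of_finite hA, inner_basisVec_avgProd_mul_coavgProd ξ _ A
      (disjoint_vertexBoundary hA), clusterWeight, dif_pos hA]
    push_cast
    rfl
  · rw [clusterProj, dif_neg hA, clusterWeight, dif_neg hA]
    simp

theorem inner_basisVec_one_sub_avgOp (ξ : Config V H) (x : V) :
    inner ℂ (basisVec ξ) ((1 - avgOp x) (basisVec ξ)) =
      ((1 - (Fintype.card H : ℝ)⁻¹ : ℝ) : ℂ) := by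
  classical
  have h := inner_basisVec_avgProd_mul_coavgProd ξ {x} ∅ (Finset.disjoint_empty_left _)
  rw [← insert_empty_eq, coavgProd_insert (Finset.notMem_empty x)] at h
  simp only [avgProd_empty, coavgProd_empty, one_mul, mul_one] at h
  rw [h]
  simp

theorem inner_self_apply_of_isStarProjection {E : Type*} [NormedAddCommGroup E]
    [InnerProductSpace ℂ E] [CompleteSpace E] {P : E →L[ℂ] E} (hP : IsStarProjection P) (y : E) :
    inner ℂ y (P y) = ((‖P y‖ ^ 2 : ℝ) : ℂ) := by
  have h1 : P (P y) = P y := DFunLike.congr_fun hP.isIdempotentElem y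
  have h2 := hP.isSelfAdjoint
  rw [ContinuousLinearMap.isSelfAdjoint_iff'] at h2
  have h3 : inner ℂ y (P y) = inner ℂ (P y) (P y) := by
    conv_lhs => rw [← h1]
    rw [← ContinuousLinearMap.adjoint_inner_left, h2]
  rw [h3, inner_self_eq_norm_sq_to_K]
  push_cast
  rfl

/-- In the subcritical regime the ranges of `1 - Θ_x` and of the projections `Θ_{A,dA}`, with `A`
running through the finite connected sets containing `x`, generate `ℓ²(ℭ)`. -/
theorem basisVec_mem_of_subcritical [Countable V]
    (hsub : ((Fintype.card H : ℝ))⁻¹ < (criticalProbability G : ℝ)) (x : V)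
    {K : Submodule ℂ (L2 (Config V H))} (hK : IsClosed (K : Set (L2 (Config V H))))
    (hA : ∀ A : Animal G, x ∈ A.1 → (clusterProj (H := H) G A.1).range ≤ K)
    (hx : (1 - avgOp (H := H) x).range ≤ K) (ξ : Config V H) : basisVec ξ ∈ K := by
  have hpos : (0 : ℝ) < (Fintype.card H : ℝ)⁻¹ :=
    inv_pos.mpr (lt_of_le_of_ne (Nat.cast_nonneg _) card_ne_zero.symm)
  let q : unitInterval :=
    ⟨(Fintype.card H : ℝ)⁻¹, hpos.le, hsub.le.trans (criticalProbability G).2.2⟩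
  let P : Unit ⊕ {A : Animal G // x ∈ A.1} → L2 (Config V H) →L[ℂ] L2 (Config V H) := fun o =>
    o.elim (fun _ => 1 - avgOp x) fun A => clusterProj G A.1.1
  have hP : ∀ o, IsStarProjection (P o) := by
    rintro (⟨⟩ | A)
    · exact (isStarProjection_avgOp x).one_sub
    · exact isStarProjection_clusterProj H G A.1.1
  have hmem : ∀ A : {A : Animal G // x ∈ A.1}, P (.inr A) (basisVec ξ) ∈
      (clusterProj (H := H) G A.1.1).range := fun A => ⟨basisVec ξ, rfl⟩
  have hmem0 : P (.inl ()) (basisVec ξ) ∈ (1 - avgOp (H := H) x).range := ⟨basisVec ξ, rfl⟩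
  have horth0 : ∀ A, inner ℂ (P (.inr A) (basisVec ξ)) (P (.inl ()) (basisVec ξ)) = 0 := fun A =>
    inner_eq_zero_of_avgOp (avgOp_of_mem_range_clusterProj A.2 (hmem A))
      (avgOp_of_mem_range_one_sub hmem0)
  have hinner := fun o => inner_self_apply_of_isStarProjection (hP o) (basisVec ξ)
  have hnorm0 : ‖P (.inl ()) (basisVec ξ)‖ ^ 2 = 1 - q :=
    Complex.ofReal_injective ((hinner (.inl ())).symm.trans (inner_basisVec_one_sub_avgOp ξ x))
  have hnorm : ∀ A, ‖P (.inr A) (basisVec ξ)‖ ^ 2 = clusterWeight G q A.1.1 := fun A =>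
    Complex.ofReal_injective ((hinner (.inr A)).symm.trans (inner_basisVec_clusterProj ξ A.1.1))
  refine mem_of_one_le_tsum_norm_sq (u := fun o => P o (basisVec ξ)) (norm_basisVec ξ) ?_ hinner ?_
    hK ?_
  · rintro (⟨⟩ | A) (⟨⟩ | B) hAB
    · exact absurd rfl hAB
    · rw [inner_eq_zero_symm]
      exact horth0 B
    · exact horth0 A
    · refine inner_eq_zero_of_mem_range_clusterProj (fun h => hAB ?_) A.2 B.2 (hmem A) (hmem B)
      rw [Subtype.ext h]
  · rw [ENNReal.summable.tsum_sum ENNReal.summable, tsum_fintype, Fintype.sum_unique]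
    change 1 ≤ ENNReal.ofReal (‖P (.inl ()) (basisVec ξ)‖ ^ 2) + _
    rw [hnorm0]
    simp_rw [hnorm]
    exact one_le_tsum_clusterWeight (q := q) hpos hsub x
  · rintro (⟨⟩ | A)
    · exact hx hmem0
    · exact hA A.1 A.2 (hmem A)

variable {enum : ℕ → Config V H} {f : ∀ A : Animal G, A.1 → L2 V}

theorem orthonormal_eigenSystem
    (hφ : ∀ A : Animal G, IsFinitelySupportedGSBasis (clusterProj G A.1) enum)
    (hψ : ∀ x : V, IsFinitelySupportedGSBasis (1 - avgOp x) enum)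
    (hf : ∀ A, Orthonormal ℂ (f A)) (hfA : ∀ A a, ∀ x ∉ A.1, f A a x = 0) :
    Orthonormal ℂ (eigenSystem G enum f) := by
  classical
  have hmixed : ∀ (A : Animal G) (i : GSIndex (clusterProj G A.1) enum) (a : A.1) (x : V)
      (j : GSIndex (1 - avgOp x) enum),
      inner ℂ (tensor (gramSchmidtSeq (clusterProj G A.1) enum i) (f A a))
        (tensor (gramSchmidtSeq (1 - avgOp x) enum j) (basisVec x)) = 0 := by
    intro A i a x j
    rw [inner_tensor]
    by_cases hx : x ∈ A.1
    · rw [inner_eq_zero_of_avgOp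
        (avgOp_of_mem_range_clusterProj hx (gramSchmidtSeq_mem_range (hφ A) i))
        (avgOp_of_mem_range_one_sub (gramSchmidtSeq_mem_range (hψ x) j)), zero_mul]
    · rw [inner_basisVec_right, hfA A a x hx, map_zero, mul_zero]
  refine ⟨?_, ?_⟩
  · rintro (⟨A, i, a⟩ | ⟨x, i⟩)
    · exact (norm_tensor _ _).trans (by rw [(hφ A).1.1 i, (hf A).1 a, mul_one])
    · exact (norm_tensor _ _).trans (by rw [(hψ x).1.1 i, norm_basisVec, mul_one])
  · rintro (⟨A, i, a⟩ | ⟨x, i⟩) (⟨B, j, b⟩ | ⟨y, j⟩) hne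
    · change inner ℂ (tensor _ _) (tensor _ _) = 0
      rw [inner_tensor]
      by_cases hAB : A = B
      · subst hAB
        by_cases hij : i = j
        · have hab : a ≠ b := by
            rintro rfl
            exact hne (by rw [hij])
          rw [(hf A).2 hab, mul_zero]
        · rw [(hφ A).1.2 hij, zero_mul]
      · by_cases hx : ∃ x, x ∈ A.1 ∧ x ∈ B.1
        · obtain ⟨x, hxA, hxB⟩ := hx
          rw [inner_eq_zero_of_mem_range_clusterProj hAB hxA hxB
            (gramSchmidtSeq_mem_range (hφ A) i) (gramSchmidtSeq_mem_range (hφ B) j), zero_mul]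
        · have h0 : inner ℂ (f A a) (f B b) = 0 := by
            rw [lp.inner_eq_tsum]
            refine (tsum_congr fun x => ?_).trans tsum_zero
            by_cases hxA : x ∈ A.1
            · rw [hfA B b x fun hxB => hx ⟨x, hxA, hxB⟩, inner_zero_right]
            · rw [hfA A a x hxA, inner_zero_left]
          rw [h0, mul_zero]
    · exact hmixed A i a y j
    · rw [inner_eq_zero_symm]
      exact hmixed B j b x i
    · change inner ℂ (tensor _ _) (tensor _ _) = 0
      rw [inner_tensor]
      by_cases hxy : x = y
      · subst hxy
        have hij : i ≠ j := by
          rintro rfl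
          exact hne rfl
        rw [(hψ x).1.2 hij, zero_mul]
      · rw [orthonormal_basisVec.2 hxy, mul_zero]

theorem span_eigenSystem [Countable V]
    (hsub : ((Fintype.card H : ℝ))⁻¹ < (criticalProbability G : ℝ))
    (hφ : ∀ A : Animal G, IsFinitelySupportedGSBasis (clusterProj G A.1) enum)
    (hψ : ∀ x : V, IsFinitelySupportedGSBasis (1 - avgOp x) enum)
    (hf : ∀ A : Animal G, Submodule.span ℂ (Set.range (f A)) = (restrictProj A.1).range) :
    (Submodule.span ℂ (Set.range (eigenSystem G enum f))).topologicalClosure = ⊤ := by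
  classical
  set K := (Submodule.span ℂ (Set.range (eigenSystem G enum f))).topologicalClosure with hKdef
  have hK : IsClosed (K : Set (L2 (Config V H × V))) := Submodule.isClosed_topologicalClosure _
  have hmem : ∀ i, eigenSystem G enum f i ∈ K := fun i =>
    Submodule.le_topologicalClosure _ (Submodule.subset_span ⟨i, rfl⟩)
  -- the vectors `φ` with `φ ⊗ e_x ∈ K` form a closed subspace
  let M : V → Submodule ℂ (L2 (Config V H)) := fun x =>
    K.comap (tensorRight (X := Config V H) (basisVec x)).toLinearMap
  have hM : ∀ x, IsClosed (M x : Set (L2 (Config V H))) := fun x =>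
    hK.preimage (tensorRight (basisVec x)).continuous
  refine eq_top_of_basisVec_mem hK ?_
  rintro ⟨ξ, x⟩
  rw [← tensor_basisVec]
  refine basisVec_mem_of_subcritical hsub x (hM x) (fun A hxA => ?_) ?_ ξ
  · rw [← (hφ A).2.1]
    refine Submodule.topologicalClosure_minimal _ ?_ (hM x)
    rw [Submodule.span_le]
    rintro _ ⟨i, rfl⟩
    set φ := gramSchmidtSeq (clusterProj G A.1) enum i with hφi
    change tensor φ (basisVec x) ∈ K
    have hle : Submodule.span ℂ (Set.range (f A)) ≤
        K.comap (tensorLeft (Y := V) φ).toLinearMap := by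
      rw [Submodule.span_le]
      rintro _ ⟨a, rfl⟩
      exact hmem (.inl ⟨A, i, a⟩)
    rw [hf A, range_restrictProj] at hle
    exact hle (Submodule.subset_span ⟨⟨x, hxA⟩, rfl⟩)
  · rw [← (hψ x).2.1]
    refine Submodule.topologicalClosure_minimal _ ?_ (hM x)
    rw [Submodule.span_le]
    rintro _ ⟨i, rfl⟩
    exact hmem (.inr ⟨x, i⟩)

end System

end Lamplighter

theorem mainTheorem3 {V H : Type*} [Countable V] [Zero H] [Fintype H] (G : SimpleGraph V)
    (p : V → V → ℝ) (hp : IsSelfAdjointWalk G p)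
    (hsub : ((Fintype.card H : ℝ))⁻¹ < (criticalProbability G : ℝ)) :
    -- a complete orthonormal system of finitely supported eigenfunctions exists
    (∃ B : Set (L2 (Config V H × V)), IsCompleteOrthonormal (fun v : B => (v : L2 (Config V H × V))) ∧
      ∀ v ∈ B, FinitelySupported v ∧ ∃ t : ℝ,
        Module.End.HasEigenvector (lampOp (H := H) p hp).toLinearMap (t : ℂ) v) ∧
    -- eigenbases of the truncations and enumerations of the configurations exist
    (∀ A : Animal G, ∃ f ev, IsTruncatedEigenbasis p hp A.1 f ev) ∧
    (∃ enum : ℕ → Config V H, Function.Surjective enum) ∧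
    -- and any choice of them yields such a system explicitly
    (∀ enum : ℕ → Config V H, Function.Surjective enum →
      (∀ A : Animal G, IsFinitelySupportedGSBasis (clusterProj G A.1) enum) ∧
      (∀ x : V, IsFinitelySupportedGSBasis (1 - avgOp x) enum) ∧
      ∀ (f : ∀ A : Animal G, A.1 → L2 V) (ev : ∀ A : Animal G, A.1 → ℝ),
        (∀ A, IsTruncatedEigenbasis p hp A.1 (f A) (ev A)) →
        IsCompleteOrthonormal (eigenSystem G enum f) ∧
        ∀ i, FinitelySupported (eigenSystem G enum f i) ∧
          lampOp p hp (eigenSystem G enum f i) =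
            (eigenValue G enum ev i : ℂ) • eigenSystem G enum f i) ∧
    HasPurePointSpectrum (lampOp (H := H) p hp) := by
  have hbasis : ∀ A : Animal G, ∃ f ev, IsTruncatedEigenbasis p hp A.1 f ev := fun A =>
    exists_isTruncatedEigenbasis hp A.1
  have henum : ∃ enum : ℕ → Config V H, Function.Surjective enum := exists_surjective_nat _
  have hmain : ∀ enum : ℕ → Config V H, Function.Surjective enum →
      (∀ A : Animal G, IsFinitelySupportedGSBasis (clusterProj G A.1) enum) ∧
      (∀ x : V, IsFinitelySupportedGSBasis (1 - avgOp x) enum) ∧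
      ∀ (f : ∀ A : Animal G, A.1 → L2 V) (ev : ∀ A : Animal G, A.1 → ℝ),
        (∀ A, IsTruncatedEigenbasis p hp A.1 (f A) (ev A)) →
        IsCompleteOrthonormal (eigenSystem G enum f) ∧
        ∀ i, FinitelySupported (eigenSystem G enum f i) ∧
          lampOp p hp (eigenSystem G enum f i) =
            (eigenValue G enum ev i : ℂ) • eigenSystem G enum f i := by
    intro enum henum
    have hφ : ∀ A : Animal G, IsFinitelySupportedGSBasis (clusterProj G A.1) enum := fun A =>
      isFinitelySupportedGSBasis_of_isIdempotentElem
        (isStarProjection_clusterProj H G A.1).isIdempotentElem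
        (fun f hf => finitelySupported_clusterProj hf G A.1) henum
    have hψ : ∀ x : V, IsFinitelySupportedGSBasis (1 - avgOp x) enum := fun x =>
      isFinitelySupportedGSBasis_of_isIdempotentElem
        (isStarProjection_avgOp x).one_sub.isIdempotentElem
        (fun f hf => finitelySupported_one_sub_avgOp hf x) henum
    refine ⟨hφ, hψ, fun f ev hf => ?_⟩
    have hfA : ∀ A a, ∀ x ∉ A.1, f A a x = 0 := fun A a => by
      refine mem_range_restrictProj.mp ?_
      rw [← (hf A).2.1]
      exact Submodule.subset_span ⟨a, rfl⟩
    refine ⟨⟨orthonormal_eigenSystem hφ hψ (fun A => (hf A).1) hfA,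
      span_eigenSystem hsub hφ hψ fun A => (hf A).2.1⟩, ?_⟩
    rintro (⟨A, i, a⟩ | ⟨x, i⟩)
    · refine ⟨((hφ A).2.2 i).tensor ((A.1.finite_toSet).subset fun x hx => ?_), ?_⟩
      · by_contra hxA
        exact hx (hfA A a x hxA)
      · change lampOp p hp (tensor _ (f A a)) = (ev A a : ℂ) • tensor _ (f A a)
        rw [lampOp_tensor hp (gramSchmidtSeq_mem_range (hφ A) i) (hfA A a), (hf A).2.2 a,
          ← tensorLeft_apply, map_smul, tensorLeft_apply]
    · refine ⟨((hψ x).2.2 i).tensor (finitelySupported_basisVec x), ?_⟩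
      change lampOp p hp (tensor _ (basisVec x)) = ((0 : ℝ) : ℂ) • _
      rw [lampOp_tensor_basisVec_eq_zero hp (gramSchmidtSeq_mem_range (hψ x) i),
        Complex.ofReal_zero, zero_smul]
  obtain ⟨enum, hsurj⟩ := henum
  choose f ev hf using hbasis
  obtain ⟨-, -, hsys⟩ := hmain enum hsurj
  obtain ⟨hcomplete, heig⟩ := hsys f ev hf
  refine ⟨⟨Set.range (eigenSystem G enum f), ⟨?_, ?_⟩, ?_⟩, fun A => ⟨f A, ev A, hf A⟩,
    ⟨enum, hsurj⟩, hmain, hcomplete.hasPurePointSpectrum fun i => (heig i).2⟩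
  · exact hcomplete.1.toSubtypeRange
  · rw [Subtype.range_coe]
    exact hcomplete.2
  · rintro _ ⟨i, rfl⟩
    exact ⟨(heig i).1, eigenValue G enum ev i, Module.End.mem_eigenspace_iff.mpr (heig i).2,
      hcomplete.1.ne_zero i⟩
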